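/- Let $K$ be a field, let $n\ge 0$, let $Q=A_n$ be the quiver $1\to 2\to\cdots\to n$, and let $\Lambda=KQ$ be its path algebra, with paths multiplied like functions, so that $\Lambda e_v$ is spanned by the paths starting at $v$. Let $\Lambda$-mod be the category of finitely generated left $\Lambda$-modules. A torsion pair on $\Lambda$-mod is a pair $(\mathcal T,\mathcal F)$ of full subcategories closed under isomorphism such that $\operatorname{Hom}(X,Y)=0$ for all $X\in\mathcal T$, $Y\in\mathcal F$, and every $X\in\Lambda$-mod has an exact sequence $0\to X_{\mathcal T}\to X\to X_{\mathcal F}\to 0$ with $X_{\mathcal T}\in\mathcal T$ and $X_{\mathcal F}\in\mathcal F$. A complete strong 1-type part partition of $A_n$ is a tuple $(\Delta_0,\Delta_1,\dots,\Delta_m)$, $m\ge 0$, of pairwise disjoint sets of vertices with union $\{1,\dots,n\}$, where $\Delta_1,\dots,\Delta_m$ are non-empty (and $\Delta_0$ may be empty), such that, with $Q^{(i)}$ the full subquiver of $A_n$ on the vertices outside $\Delta_0\cup\cdots\cup\Delta_{i-1}$, for every $1\le i\le m$ the set $\Delta_i$ contains all sinks of $Q^{(i)}$ if $i$ is odd,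 and all sources of $Q^{(i)}$ if $i$ is even. Theorem. There is a bijection between the torsion pairs on $KA_n$-mod and the complete strong 1-type part partitions of $A_n$. More precisely, there is such a bijection under which the partition $(\Delta_0,\dots,\Delta_m)$ attached to $(\mathcal T,\mathcal F)$ satisfies, for every $0\le i\le m$ and with $\Lambda^i=KQ^{(i)}$ regarded as the quotient of $\Lambda$ by the ideal generated by the $e_w$ with $w\in\Delta_0\cup\cdots\cup\Delta_{i-1}$: if $i$ is even, $\Delta_i$ is the set of vertices $v$ of $Q^{(i)}$ with $\Lambda^i e_v\in\mathcal T$; if $i$ is odd, $\Delta_i$ is the set of vertices $v$ of $Q^{(i)}$ with $\operatorname{Hom}_K(e_v\Lambda^i,K)\in\mathcal F$. -/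

import Mathlib

universe u v w

/-! ### The path algebra of a finite quiver -/

/-- The path algebra `KQ`: the vector space over `K` with basis all paths of the quiver
(the paths of length zero included). -/
def PathAlgebra (K : Type u) (V : Type v) [Field K] [Quiver.{w} V] : Type _ :=
  (Σ a b : V, Quiver.Path a b) →₀ K

namespace PathAlgebra

variable {K : Type u} {V : Type v} [Field K] [Quiver.{w} V]

noncomputable instance : AddCommGroup (PathAlgebra K V) :=
  inferInstanceAs (AddCommGroup ((Σ a b : V, Quiver.Path a b) →₀ K))

noncomputable instance : Module K (PathAlgebra K V) :=
  inferInstanceAs (Module K ((Σ a b : V, Quiver.Path a b) →₀ K))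

/-- A path, as a basis vector of the path algebra. -/
noncomputable def ofPath (p : Σ a b : V, Quiver.Path a b) : PathAlgebra K V :=
  Finsupp.single p 1

/-- The linear map out of the path algebra with prescribed values on paths. -/
noncomputable def lift {M : Type*} [AddCommGroup M] [Module K M]
    (f : (Σ a b : V, Quiver.Path a b) → M) : PathAlgebra K V →ₗ[K] M :=
  Finsupp.linearCombination K f

theorem lift_ofPath {M : Type*} [AddCommGroup M] [Module K M]
    (f : (Σ a b : V, Quiver.Path a b) → M) (p : Σ a b : V, Quiver.Path a b) :
    lift (K := K) f (ofPath p) = f p :=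
  (Finsupp.linearCombination_single K (1 : K) p).trans (one_smul K (f p))

/-- Two linear maps out of the path algebra agree if they agree on paths. -/
theorem hom_ext {M : Type*} [AddCommGroup M] [Module K M] {f g : PathAlgebra K V →ₗ[K] M}
    (h : ∀ p, f (ofPath p) = g (ofPath p)) : f = g :=
  Finsupp.lhom_ext' fun p => LinearMap.ext_ring (h p)

/-- The idempotent `e_v`, the path of length zero at the vertex `v`. -/
noncomputable def idem (v : V) : PathAlgebra K V := ofPath ⟨v, v, Quiver.Path.nil⟩

noncomputable instance [Fintype V] : One (PathAlgebra K V) := ⟨∑ v, idem v⟩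

theorem one_def [Fintype V] : (1 : PathAlgebra K V) = ∑ v, idem v := rfl

variable [DecidableEq V]

/-- The product `p * q` of two paths: first walk along `q`, then along `p`, if `q` ends where `p`
begins; zero otherwise. With this order of factors the left ideal `KQ e_v` is spanned by the paths
that start at `v`, and left modules are the (covariant) representations of the quiver. -/
noncomputable def mulPath (p q : Σ a b : V, Quiver.Path a b) : PathAlgebra K V :=
  if h : q.2.1 = p.1 then ofPath ⟨q.1, p.2.1, (q.2.2.cast rfl h).comp p.2.2⟩ else 0

/-- The bilinear extension of the product of paths. -/
noncomputable def mulLin : PathAlgebra K V →ₗ[K] PathAlgebra K V →ₗ[K] PathAlgebra K V :=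
  lift fun p => lift fun q => mulPath p q

noncomputable instance : Mul (PathAlgebra K V) := ⟨fun x y => mulLin x y⟩

theorem mul_def (x y : PathAlgebra K V) : x * y = mulLin x y := rfl

theorem mulLin_ofPath (p q : Σ a b : V, Quiver.Path a b) :
    mulLin (ofPath p : PathAlgebra K V) (ofPath q) = mulPath p q := by
  rw [mulLin, lift_ofPath, lift_ofPath]

theorem mulLin_assoc_ofPath (p q r : Σ a b : V, Quiver.Path a b) :
    mulLin (mulPath p q : PathAlgebra K V) (ofPath r) =
      mulLin (ofPath p) (mulPath q r : PathAlgebra K V) := by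
  obtain ⟨a, b, p⟩ := p
  obtain ⟨c, d, q⟩ := q
  obtain ⟨e, f, r⟩ := r
  by_cases h₁ : d = a <;> by_cases h₂ : f = c
  · subst h₁ h₂
    simp [mulPath, mulLin_ofPath, Quiver.Path.comp_assoc]
  all_goals simp [mulPath, h₁, h₂, mulLin_ofPath]

theorem ofPath_mul_ofPath (p q : Σ a b : V, Quiver.Path a b) :
    (ofPath p * ofPath q : PathAlgebra K V) = mulPath p q := mulLin_ofPath p q

variable [Fintype V]

theorem mulLin_one_left (p : Σ a b : V, Quiver.Path a b) :
    mulLin (1 : PathAlgebra K V) (ofPath p) = ofPath p := by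
  obtain ⟨a, b, p⟩ := p
  rw [one_def, map_sum, LinearMap.sum_apply, Finset.sum_eq_single b]
  · simp [idem, mulLin_ofPath, mulPath]
  · intro c _ hc
    simp [idem, mulLin_ofPath, mulPath, hc.symm]
  · simp

theorem mulLin_one_right (p : Σ a b : V, Quiver.Path a b) :
    mulLin (ofPath p) (1 : PathAlgebra K V) = ofPath p := by
  obtain ⟨a, b, p⟩ := p
  rw [one_def, map_sum, Finset.sum_eq_single a]
  · simp [idem, mulLin_ofPath, mulPath]
  · intro c _ hc
    simp [idem, mulLin_ofPath, mulPath, hc]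
  · simp

noncomputable instance : Ring (PathAlgebra K V) where
  __ := (inferInstance : AddCommGroup (PathAlgebra K V))
  left_distrib x y z := by simp [mul_def]
  right_distrib x y z := by simp [mul_def]
  zero_mul x := by simp [mul_def]
  mul_zero x := by simp [mul_def]
  one_mul x := by
    have : (mulLin (1 : PathAlgebra K V)) = LinearMap.id := hom_ext fun p => by
      simpa using mulLin_one_left p
    rw [mul_def, this, LinearMap.id_apply]
  mul_one x := by
    have : (mulLin (K := K) (V := V)).flip 1 = LinearMap.id := hom_ext fun p => by
      simpa using mulLin_one_right p
    exact LinearMap.congr_fun this x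
  mul_assoc x y z := by
    have : (mulLin (K := K) (V := V)).compr₂ mulLin =
        ((LinearMap.llcomp K (PathAlgebra K V) (PathAlgebra K V) (PathAlgebra K V)).flip.comp
          (mulLin (K := K) (V := V))).flip.comp mulLin := by
      refine hom_ext fun p => hom_ext fun q => hom_ext fun r => ?_
      simpa [mulLin_ofPath] using mulLin_assoc_ofPath p q r
    exact LinearMap.congr_fun (LinearMap.congr_fun (LinearMap.congr_fun this x) y) z

noncomputable instance : Algebra K (PathAlgebra K V) :=
  Algebra.ofModule (fun c x y => by simp [mul_def]) (fun c x y => by simp [mul_def])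

/-! ### Projective and injective modules of the quotients attached to sets of vertices -/

variable (K)

/-- For a set `U` of vertices, the two-sided ideal `Λ ε Λ` of `Λ = KQ`, where `ε` is the sum of
the idempotents `e_w` with `w` outside `U`; it is recorded as a left ideal. -/
noncomputable def outsideIdeal (U : Set V) : Submodule (PathAlgebra K V) (PathAlgebra K V) :=
  Submodule.span (PathAlgebra K V) {x | ∃ w, w ∉ U ∧ ∃ a : PathAlgebra K V, x = idem w * a}

/-- With `Λ_U = Λ / Λ ε Λ` (the path algebra of the full subquiver on `U`), the projective
`Λ_U`-module `Λ_U e_v`, as a left `Λ`-module. -/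
noncomputable def projModule (U : Set V) (v : V) :
    Submodule (PathAlgebra K V) (PathAlgebra K V ⧸ outsideIdeal K U) :=
  Submodule.span (PathAlgebra K V) {(outsideIdeal K U).mkQ (idem v)}

variable (V)

/-- The dual `D(Λ) = Hom_K(Λ, K)` of the right regular module of `Λ = KQ`. -/
def DualRegular : Type _ := PathAlgebra K V →ₗ[K] K

noncomputable instance : AddCommGroup (DualRegular K V) :=
  inferInstanceAs (AddCommGroup (PathAlgebra K V →ₗ[K] K))

instance : FunLike (DualRegular K V) (PathAlgebra K V) K :=
  inferInstanceAs (FunLike (PathAlgebra K V →ₗ[K] K) (PathAlgebra K V) K)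

/-- The left `Λ`-module structure on `D(Λ)`: `(a • f) x = f (x * a)`. -/
noncomputable instance : Module (PathAlgebra K V) (DualRegular K V) where
  smul a f := LinearMap.comp (M₂ := PathAlgebra K V) f (LinearMap.mulRight K a)
  one_smul f := LinearMap.ext fun x => congrArg f (mul_one x)
  mul_smul a b f := LinearMap.ext fun x => congrArg f (mul_assoc x a b).symm
  smul_zero _ := rfl
  smul_add _ _ _ := rfl
  add_smul a b f := LinearMap.ext fun x =>
    (congrArg f (mul_add x a b)).trans (LinearMap.map_add (M := PathAlgebra K V) f _ _)
  zero_smul f := LinearMap.ext fun x =>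
    (congrArg f (mul_zero x)).trans (LinearMap.map_zero (M := PathAlgebra K V) f)

theorem DualRegular.smul_apply (a x : PathAlgebra K V) (f : DualRegular K V) :
    (a • f) x = f (x * a) := rfl

variable {V}

/-- The injective `Λ_U`-module `D(e_v Λ_U)`, as a left `Λ`-module: the linear forms on `Λ` that
factor through the projection `x ↦ e_v x` and vanish on the ideal `Λ ε Λ`. -/
noncomputable def injModule (U : Set V) (v : V) : Submodule (PathAlgebra K V) (DualRegular K V) where
  carrier := {f | (∀ x, f (idem v * x) = f x) ∧ ∀ x ∈ outsideIdeal K U, f x = 0}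
  add_mem' {f g} hf hg :=
    ⟨fun x => congrArg₂ (· + ·) (hf.1 x) (hg.1 x), fun x hx =>
      (congrArg₂ (· + ·) (hf.2 x hx) (hg.2 x hx)).trans (add_zero (0 : K))⟩
  zero_mem' := ⟨fun _ => rfl, fun _ _ => rfl⟩
  smul_mem' a f hf := by
    refine ⟨fun x => ?_, fun x hx => ?_⟩
    · rw [DualRegular.smul_apply, DualRegular.smul_apply, mul_assoc]
      exact hf.1 _
    · rw [DualRegular.smul_apply]
      refine hf.2 _ ?_
      induction hx using Submodule.span_induction with
      | mem x hx =>
        obtain ⟨w, hw, b, rfl⟩ := hx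
        exact Submodule.subset_span ⟨w, hw, b * a, mul_assoc _ _ _⟩
      | zero => rw [zero_mul]; exact Submodule.zero_mem _
      | add x y _ _ h₁ h₂ => rw [add_mul]; exact Submodule.add_mem _ h₁ h₂
      | smul c x _ h => rw [smul_mul_assoc]; exact Submodule.smul_mem _ c h

end PathAlgebra

/-! ### Torsion pairs -/

/-- A torsion pair on the category `R`-mod of finitely generated left `R`-modules: a pair of full
subcategories, closed under isomorphism, such that there is no nonzero homomorphism from the first
to the second, and every finitely generated module is an extension of one in the second by one in
the first. -/
@[ext]
structure TorsionPair (R : Type u) [Ring R] where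
  /-- the torsion class -/
  T : CategoryTheory.ObjectProperty (ModuleCat.{u} R)
  /-- the torsion-free class -/
  F : CategoryTheory.ObjectProperty (ModuleCat.{u} R)
  T_fg : T ≤ ModuleCat.isFG R
  F_fg : F ≤ ModuleCat.isFG R
  T_iso : T.IsClosedUnderIsomorphisms
  F_iso : F.IsClosedUnderIsomorphisms
  hom_eq_zero : ∀ X Y : ModuleCat.{u} R, T X → F Y → ∀ f : X →ₗ[R] Y, f = 0
  exists_exact : ∀ X : ModuleCat.{u} R, Module.Finite R X →
    ∃ (A B : ModuleCat.{u} R) (i : A →ₗ[R] X) (p : X →ₗ[R] B),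
      T A ∧ F B ∧ Function.Injective i ∧ Function.Exact i p ∧ Function.Surjective p

/-! ### Part partitions of the vertex set of a quiver -/

/-- The sinks of the full subquiver on the set `U` of vertices. -/
def sinksIn {V : Type v} [Quiver.{w} V] (U : Set V) : Set V :=
  {a | a ∈ U ∧ ∀ b ∈ U, IsEmpty (a ⟶ b)}

/-- The sources of the full subquiver on the set `U` of vertices. -/
def sourcesIn {V : Type v} [Quiver.{w} V] (U : Set V) : Set V :=
  {a | a ∈ U ∧ ∀ b ∈ U, IsEmpty (b ⟶ a)}

/-- The vertices outside `Δ_0 ∪ ⋯ ∪ Δ_{i-1}`. -/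
def restBefore {V : Type v} {m : ℕ} (Δ : Fin (m + 1) → Set V) (i : Fin (m + 1)) : Set V :=
  {a | ∀ j < i, a ∉ Δ j}

/-- A strong 1-type part partition `(Δ_0, …, Δ_m)` of a quiver; `Δ_0` may be empty, the other
parts may not. -/
structure StrongOneTypePartPartition (V : Type v) [Quiver.{w} V] where
  m : ℕ
  Δ : Fin (m + 1) → Set V
  nonempty : ∀ i, i ≠ 0 → (Δ i).Nonempty
  disjoint : ∀ i j, i ≠ j → Disjoint (Δ i) (Δ j)
  sinks_subset : ∀ i : Fin (m + 1), Odd (i : ℕ) → sinksIn (restBefore Δ i) ⊆ Δ i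
  sources_subset : ∀ i : Fin (m + 1), i ≠ 0 → Even (i : ℕ) → sourcesIn (restBefore Δ i) ⊆ Δ i

/-- A part partition is complete if its parts cover all vertices. -/
def StrongOneTypePartPartition.IsComplete {V : Type v} [Quiver.{w} V]
    (S : StrongOneTypePartPartition V) : Prop :=
  ⋃ i, S.Δ i = Set.univ

/-- `S = (Δ_0, …, Δ_m)` is obtained from the torsion pair `(T, F)` on `KQ`-mod by alternately
splitting off projectives of `T` and injectives of `F`: with `Λ^i` the path algebra of the full
subquiver on the vertices outside `Δ_0 ∪ ⋯ ∪ Δ_{i-1}`, the set `Δ_i` consists of those of these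
vertices `v` for which `Λ^i e_v` lies in `T` (`i` even), respectively for which `D(e_v Λ^i)` lies
in `F` (`i` odd). -/
def IsDecompositionOf {K : Type u} {V : Type v} [Field K] [Quiver.{w} V] [DecidableEq V] [Fintype V]
    (S : StrongOneTypePartPartition V) (P : TorsionPair (PathAlgebra K V)) : Prop :=
  ∀ i, ∀ a ∈ restBefore S.Δ i,
    (Even (i : ℕ) →
      (a ∈ S.Δ i ↔ P.T (ModuleCat.of _ (PathAlgebra.projModule K (restBefore S.Δ i) a)))) ∧
    (Odd (i : ℕ) →
      (a ∈ S.Δ i ↔ P.F (ModuleCat.of _ (PathAlgebra.injModule K (restBefore S.Δ i) a))))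

/-! ### The linearly oriented quiver of type `A_n` -/

/-- The vertices of the quiver `1 → 2 → ⋯ → n`; the vertex `k` is the element `k - 1` of `Fin n`. -/
def LinearQuiver (n : ℕ) : Type := Fin n

instance (n : ℕ) : DecidableEq (LinearQuiver n) := inferInstanceAs (DecidableEq (Fin n))

instance (n : ℕ) : Fintype (LinearQuiver n) := inferInstanceAs (Fintype (Fin n))

/-- There is exactly one arrow from `i` to `j` if `j = i + 1`, and none otherwise. -/
instance (n : ℕ) : Quiver.{0} (LinearQuiver n) where
  Hom i j := PLift (Fin.val i + 1 = Fin.val j)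

/-! Modules supported on a set `U` of vertices are the modules over the quotient Λ_U. There P(a) =
Λ_U e_a represents the functor M ↦ e_a M, and maps from M to I(a) = D(e_a Λ_U) detect whether e_a M
is zero. So for a torsion pair (T, F) on these modules, P(a) lies in T iff every module in F
vanishes at a, and I(a) lies in F iff every module in T vanishes at a (`left_projModule_iff`,
`right_injModule_iff`). Deleting the vertices a with P(a) ∈ T therefore leaves F unchanged and
merely restricts T (`restrict_left`). Nothing is lost, since T is the left perpendicular class of F;
conversely every torsion pair on a smaller vertex set extends in this way (`extend_left`). The dual
statements hold for injectives.

The shape of A_n enters through intervals. If a is a sink of `U`, each nonzero submodule of I(a) is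
isomorphic to some P(j); if a is a source, each nonzero quotient of P(a) is isomorphic to some I(j)
(`exists_projModule_equiv`, `exists_equiv_injModule`). Once no P(j) lies in T, the image in I(a) of
a module of T must vanish, so I(a) ∈ F for every sink a; dually for sources. Hence each part after
the initial one contains the required sinks or sources, is nonempty while vertices remain, and the
process exhausts the quiver. No step precedes Δ_0, so it carries no condition.

Conversely, a partition yields a torsion pair by starting with zero modules on the empty set and
extending backwards (`exists_isTorsionPairOn`). The sink condition prevents too many vertices from
splitting off: a surviving vertex a is joined within the remainder to a sink s, and I(s) ∈ F is
nonzero at a, so P(a) ∉ T. The same backward recursion shows that the partition determines the pair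
(`eq_of_splitsAt`), and a forward recursion that the pair determines the partition
(`IsDecompositionOf.unique`). -/

namespace PathAlgebra

/-! ### Modules supported on a set of vertices -/

section General

variable {K : Type u} {V : Type v} [Field K] [Quiver.{w} V] [DecidableEq V]

theorem idem_mul_self (a : V) : (idem a * idem a : PathAlgebra K V) = idem a := by
  simp [idem, ofPath_mul_ofPath, mulPath]

theorem idem_mul_of_ne {a b : V} (h : a ≠ b) : (idem a * idem b : PathAlgebra K V) = 0 := by
  simp [idem, ofPath_mul_ofPath, mulPath, h.symm]

variable [Fintype V]

variable (K) in
/-- The module `M` is supported on the set `U` of vertices, that is, it is a module over the path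
algebra of the full subquiver on `U`. -/
def SupportedIn (U : Set V) (M : Type*) [AddCommGroup M] [Module (PathAlgebra K V) M] : Prop :=
  ∀ a, a ∉ U → ∀ x : M, (idem a : PathAlgebra K V) • x = 0

variable {U U' : Set V} {M N : Type*} [AddCommGroup M] [Module (PathAlgebra K V) M]
  [AddCommGroup N] [Module (PathAlgebra K V) N]

theorem sum_idem_smul (x : M) : ∑ a, (idem a : PathAlgebra K V) • x = x := by
  rw [← Finset.sum_smul, ← one_def, one_smul]

theorem idem_smul_idem_smul (a : V) (x : M) :
    (idem a : PathAlgebra K V) • (idem a : PathAlgebra K V) • x = (idem a : PathAlgebra K V) • x := by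
  rw [smul_smul, idem_mul_self]

theorem SupportedIn.mono (h : SupportedIn K U M) (hU : U ⊆ U') : SupportedIn K U' M :=
  fun a ha x => h a (fun h' => ha (hU h')) x

theorem SupportedIn.of_injective (h : SupportedIn K U N) (f : M →ₗ[PathAlgebra K V] N)
    (hf : Function.Injective f) : SupportedIn K U M := fun a ha x =>
  hf (by rw [map_smul, map_zero, h a ha (f x)])

theorem SupportedIn.of_surjective (h : SupportedIn K U M) (f : M →ₗ[PathAlgebra K V] N)
    (hf : Function.Surjective f) : SupportedIn K U N := fun a ha y => by
  obtain ⟨x, rfl⟩ := hf y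
  rw [← map_smul, h a ha x, map_zero]

theorem SupportedIn.submodule (h : SupportedIn K U M) (p : Submodule (PathAlgebra K V) M) :
    SupportedIn K U p := h.of_injective p.subtype p.subtype_injective

theorem SupportedIn.univ : SupportedIn K (Set.univ : Set V) M := fun a ha => (ha (Set.mem_univ a)).elim

theorem SupportedIn.mem_of_ne_zero (h : SupportedIn K U M) {a : V} {x : M}
    (hx : (idem a : PathAlgebra K V) • x ≠ 0) : a ∈ U := by
  by_contra ha
  exact hx (h a ha x)

theorem SupportedIn.subsingleton (h : SupportedIn K (∅ : Set V) M) : Subsingleton M :=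
  subsingleton_of_forall_eq 0 fun x => by
    rw [← sum_idem_smul (K := K) (V := V) x]
    exact Finset.sum_eq_zero fun a _ => h a (Set.notMem_empty a) x

theorem SupportedIn.smul_eq_zero (h : SupportedIn K U M) {x : PathAlgebra K V}
    (hx : x ∈ outsideIdeal K U) (m : M) : x • m = 0 := by
  induction hx using Submodule.span_induction with
  | mem x hx =>
    obtain ⟨w, hw, b, rfl⟩ := hx
    rw [mul_smul, h w hw]
  | zero => rw [zero_smul]
  | add x y _ _ h₁ h₂ => rw [add_smul, h₁, h₂, add_zero]
  | smul c x _ h => rw [smul_eq_mul, mul_smul, h, smul_zero]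

theorem mul_idem_mul_mem_outsideIdeal {a : V} (ha : a ∉ U) (x y : PathAlgebra K V) :
    x * (idem a * y) ∈ outsideIdeal K U :=
  Submodule.smul_mem _ x (Submodule.subset_span ⟨a, ha, y, rfl⟩)

/-! ### The projective modules -/

variable (K) in
/-- The generator of the projective module attached to a vertex. -/
noncomputable def projGen (U : Set V) (a : V) : projModule K U a :=
  ⟨(outsideIdeal K U).mkQ (idem a), Submodule.mem_span_singleton_self _⟩

theorem exists_smul_projGen {a : V} (z : projModule K U a) :
    ∃ x : PathAlgebra K V, z = x • projGen K U a := by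
  obtain ⟨x, hx⟩ := Submodule.mem_span_singleton.1 z.2
  exact ⟨x, Subtype.ext hx.symm⟩

theorem idem_smul_projGen (U : Set V) (a : V) :
    (idem a : PathAlgebra K V) • projGen K U a = projGen K U a := by
  refine Subtype.ext ?_
  change (idem a : PathAlgebra K V) • (outsideIdeal K U).mkQ (idem a) = (outsideIdeal K U).mkQ _
  rw [← map_smul, smul_eq_mul, idem_mul_self]

theorem supportedIn_projModule (U : Set V) (a : V) : SupportedIn K U (projModule K U a) := by
  refine SupportedIn.submodule (fun w hw x => ?_) _
  obtain ⟨y, rfl⟩ := (outsideIdeal K U).mkQ_surjective x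
  rw [← map_smul, Submodule.mkQ_apply, Submodule.Quotient.mk_eq_zero]
  exact Submodule.subset_span ⟨w, hw, y, rfl⟩

instance (U : Set V) (a : V) : Module.Finite (PathAlgebra K V) (projModule K U a) :=
  Module.Finite.span_singleton _ _

theorem projModule_hom_eq_zero {a : V} {f : projModule K U a →ₗ[PathAlgebra K V] M}
    (h : f (projGen K U a) = 0) : f = 0 := by
  ext z
  obtain ⟨x, hx⟩ := exists_smul_projGen z
  rw [hx, map_smul, h, smul_zero, LinearMap.zero_apply]

/-- The homomorphism from the projective module at `a` given by the element `idem a • y`. -/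
noncomputable def projLift (hM : SupportedIn K U M) (a : V) (y : M) :
    projModule K U a →ₗ[PathAlgebra K V] M :=
  ((outsideIdeal K U).liftQ (LinearMap.toSpanSingleton (PathAlgebra K V) M y) fun x hx => by
    rw [LinearMap.mem_ker, LinearMap.toSpanSingleton_apply, hM.smul_eq_zero hx]).comp
    (projModule K U a).subtype

theorem projLift_projGen (hM : SupportedIn K U M) (a : V) (y : M) :
    projLift hM a y (projGen K U a) = (idem a : PathAlgebra K V) • y := rfl

/-! ### The injective modules -/

theorem DualRegular.ext {f g : DualRegular K V} (h : ∀ x, f x = g x) : f = g :=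
  LinearMap.ext (M := PathAlgebra K V) h

theorem DualRegular.map_zero (f : DualRegular K V) : f (0 : PathAlgebra K V) = 0 :=
  LinearMap.map_zero (M := PathAlgebra K V) f

theorem DualRegular.map_smul (f : DualRegular K V) (c : K) (x : PathAlgebra K V) :
    f (c • x) = c * f x := LinearMap.map_smul (M := PathAlgebra K V) f c x

theorem injModule_idem_mul {a : V} (f : injModule K U a) (x : PathAlgebra K V) :
    f.1 (idem a * x) = f.1 x := f.2.1 x

theorem injModule_apply_eq_zero {a : V} (f : injModule K U a) {x : PathAlgebra K V}
    (hx : x ∈ outsideIdeal K U) : f.1 x = 0 := f.2.2 x hx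

theorem supportedIn_injModule (U : Set V) (a : V) : SupportedIn K U (injModule K U a) := by
  intro w hw f
  refine Subtype.ext (DualRegular.ext fun x => ?_)
  change f.1 (x * idem w) = 0
  refine injModule_apply_eq_zero f ?_
  simpa using mul_idem_mul_mem_outsideIdeal (K := K) hw x 1

theorem hom_injModule_eq_zero {a : V} {f : M →ₗ[PathAlgebra K V] injModule K U a}
    (h : ∀ x : M, (idem a : PathAlgebra K V) • x = 0) : f = 0 := by
  ext m
  refine DualRegular.ext fun x => ?_
  have h₁ : f ((idem a * x : PathAlgebra K V) • m) = 0 := by rw [mul_smul, h, map_zero]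
  have h₂ : ((idem a * x : PathAlgebra K V) • (f m).1) 1 = 0 := by
    rw [map_smul] at h₁
    exact congrArg (fun g : injModule K U a => g.1 1) h₁
  rwa [DualRegular.smul_apply, one_mul, injModule_idem_mul] at h₂

section Lift

variable [Module K M] [IsScalarTower K (PathAlgebra K V) M]

/-- The homomorphism to the injective module at `a` given by a linear form. -/
noncomputable def injLift (hM : SupportedIn K U M) (a : V) (φ : M →ₗ[K] K) :
    M →ₗ[PathAlgebra K V] injModule K U a where
  toFun m := ⟨φ.comp ((LinearMap.toSpanSingleton (PathAlgebra K V) M m).restrictScalars K ∘ₗ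
      LinearMap.mulLeft K (idem a)), fun x => by
        change φ ((idem a * (idem a * x)) • m) = φ ((idem a * x) • m)
        rw [← mul_assoc, idem_mul_self], fun x hx => by
        change φ ((idem a * x) • m) = 0
        rw [mul_smul, hM.smul_eq_zero hx, smul_zero, map_zero]⟩
  map_add' m m' := Subtype.ext <| DualRegular.ext fun x => by
    change φ ((idem a * x) • (m + m')) = φ ((idem a * x) • m) + φ ((idem a * x) • m')
    rw [smul_add, map_add]
  map_smul' y m := Subtype.ext <| DualRegular.ext fun x => by
    change φ ((idem a * x) • (y • m)) = φ ((idem a * (x * y)) • m)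
    rw [smul_smul, mul_assoc]

theorem injLift_apply (hM : SupportedIn K U M) (a : V) (φ : M →ₗ[K] K) (m : M)
    (x : PathAlgebra K V) : (injLift hM a φ m).1 x = φ ((idem a * x) • m) := rfl

end Lift

/-- A module supported on `U` without homomorphisms to the injective module at `a` vanishes
at `a`. -/
theorem idem_smul_eq_zero_of_hom (hM : SupportedIn K U M) {a : V}
    (h : ∀ f : M →ₗ[PathAlgebra K V] injModule K U a, f = 0) (x : M) :
    (idem a : PathAlgebra K V) • x = 0 := by
  -- Linear forms on M need a K-structure, which is pulled back from the algebra. They separate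
  -- points, and the lift of a form φ sends x to a functional with value φ(e_a x) at 1.
  let _ : Module K M := Module.compHom M (algebraMap K (PathAlgebra K V))
  have : IsScalarTower K (PathAlgebra K V) M := ⟨fun c x m => by
    change (c • x) • m = algebraMap K (PathAlgebra K V) c • x • m
    rw [Algebra.smul_def, mul_smul]⟩
  rw [← Module.forall_dual_apply_eq_zero_iff K]
  intro φ
  have h₁ := congrArg (fun f : M →ₗ[PathAlgebra K V] injModule K U a => (f x).1 1)
    (h (injLift hM a φ))
  simp only [injLift_apply, mul_one] at h₁
  exact h₁

noncomputable instance : Module K (DualRegular K V) :=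
  inferInstanceAs (Module K (PathAlgebra K V →ₗ[K] K))

instance : IsScalarTower K (PathAlgebra K V) (DualRegular K V) :=
  ⟨fun c x f => DualRegular.ext fun y => by
    change f (y * (c • x)) = c * f (y * x)
    rw [mul_smul_comm, DualRegular.map_smul]⟩

instance [h : FiniteDimensional K (PathAlgebra K V)] (U : Set V) (a : V) :
    Module.Finite (PathAlgebra K V) (injModule K U a) := by
  have : FiniteDimensional K (DualRegular K V) :=
    inferInstanceAs (FiniteDimensional K (PathAlgebra K V →ₗ[K] K))
  have : Module.Finite K (injModule K U a) :=
    inferInstanceAs (Module.Finite K ((injModule K U a).restrictScalars K))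
  exact Module.Finite.of_restrictScalars_finite K (PathAlgebra K V) _

end General

end PathAlgebra

/-! ### Torsion pairs on the modules supported on a set of vertices -/

namespace PathAlgebra

section TorsionPairsOn

open CategoryTheory

variable {K : Type u} {V : Type} [Field K] [Quiver.{0} V] [DecidableEq V] [Fintype V]

variable (K) in
/-- The finitely generated modules supported on `U` without homomorphisms to `F`. -/
def leftPerp (U : Set V) (F : ObjectProperty (ModuleCat.{u} (PathAlgebra K V))) :
    ObjectProperty (ModuleCat.{u} (PathAlgebra K V)) := fun X =>
  Module.Finite (PathAlgebra K V) X ∧ SupportedIn K U X ∧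
    ∀ Y : ModuleCat.{u} (PathAlgebra K V), F Y → ∀ f : X →ₗ[PathAlgebra K V] Y, f = 0

variable (K) in
/-- The finitely generated modules supported on `U` without homomorphisms from `T`. -/
def rightPerp (U : Set V) (T : ObjectProperty (ModuleCat.{u} (PathAlgebra K V))) :
    ObjectProperty (ModuleCat.{u} (PathAlgebra K V)) := fun Y =>
  Module.Finite (PathAlgebra K V) Y ∧ SupportedIn K U Y ∧
    ∀ X : ModuleCat.{u} (PathAlgebra K V), T X → ∀ f : X →ₗ[PathAlgebra K V] Y, f = 0

/-- The modules in `T` that are supported on `U`. -/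
def restrictTo (U : Set V) (T : ObjectProperty (ModuleCat.{u} (PathAlgebra K V))) :
    ObjectProperty (ModuleCat.{u} (PathAlgebra K V)) := fun X => T X ∧ SupportedIn K U X

/-- `(T, F)` is a torsion pair on the category of finitely generated modules supported on `U`,
expressed by mutual orthogonality. -/
structure IsTorsionPairOn (U : Set V) (T F : ObjectProperty (ModuleCat.{u} (PathAlgebra K V))) :
    Prop where
  left_eq : T = leftPerp K U F
  right_eq : F = rightPerp K U T

variable {U U' : Set V} {T F : ObjectProperty (ModuleCat.{u} (PathAlgebra K V))}

namespace IsTorsionPairOn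

theorem left_iff (h : IsTorsionPairOn U T F) (X : ModuleCat.{u} (PathAlgebra K V)) :
    T X ↔ Module.Finite (PathAlgebra K V) X ∧ SupportedIn K U X ∧
      ∀ Y : ModuleCat.{u} (PathAlgebra K V), F Y → ∀ f : X →ₗ[PathAlgebra K V] Y, f = 0 :=
  iff_of_eq (congrFun h.left_eq X)

theorem right_iff (h : IsTorsionPairOn U T F) (Y : ModuleCat.{u} (PathAlgebra K V)) :
    F Y ↔ Module.Finite (PathAlgebra K V) Y ∧ SupportedIn K U Y ∧
      ∀ X : ModuleCat.{u} (PathAlgebra K V), T X → ∀ f : X →ₗ[PathAlgebra K V] Y, f = 0 :=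
  iff_of_eq (congrFun h.right_eq Y)

theorem hom_eq_zero (h : IsTorsionPairOn U T F) {X Y : ModuleCat.{u} (PathAlgebra K V)} (hX : T X)
    (hY : F Y) (f : X →ₗ[PathAlgebra K V] Y) : f = 0 := ((h.left_iff X).1 hX).2.2 Y hY f

theorem left_of_surjective (h : IsTorsionPairOn U T F) {X Y : ModuleCat.{u} (PathAlgebra K V)}
    (hX : T X) (f : X →ₗ[PathAlgebra K V] Y) (hf : Function.Surjective f) : T Y := by
  obtain ⟨h₁, h₂, h₃⟩ := (h.left_iff X).1 hX
  refine (h.left_iff Y).2 ⟨Module.Finite.of_surjective f hf, h₂.of_surjective f hf,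
    fun Z hZ g => ?_⟩
  have := h₃ Z hZ (g.comp f)
  ext y
  obtain ⟨x, rfl⟩ := hf y
  exact LinearMap.congr_fun this x

theorem right_of_injective [FiniteDimensional K (PathAlgebra K V)] (h : IsTorsionPairOn U T F)
    {X Y : ModuleCat.{u} (PathAlgebra K V)} (hY : F Y) (f : X →ₗ[PathAlgebra K V] Y)
    (hf : Function.Injective f) : F X := by
  have : IsNoetherianRing (PathAlgebra K V) := IsNoetherianRing.of_finite K _
  obtain ⟨h₁, h₂, h₃⟩ := (h.right_iff Y).1 hY
  refine (h.right_iff X).2 ⟨Module.Finite.of_injective f hf, h₂.of_injective f hf,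
    fun Z hZ g => ?_⟩
  have := h₃ Z hZ (f.comp g)
  ext z
  exact hf ((LinearMap.congr_fun this z).trans (map_zero f).symm)

/-- The projective module at `a` is torsion if and only if all torsion-free modules vanish
at `a`. -/
theorem left_projModule_iff (h : IsTorsionPairOn U T F) (a : V) :
    T (ModuleCat.of _ (projModule K U a)) ↔
      ∀ Y : ModuleCat.{u} (PathAlgebra K V), F Y → ∀ y : Y, (idem a : PathAlgebra K V) • y = 0 := by
  constructor
  · intro hT Y hY y
    have h₁ := h.hom_eq_zero hT hY (projLift ((h.right_iff Y).1 hY).2.1 a y)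
    rw [← projLift_projGen ((h.right_iff Y).1 hY).2.1 a y]
    exact LinearMap.congr_fun h₁ _
  · intro hF
    refine (h.left_iff _).2 ⟨inferInstanceAs (Module.Finite _ (projModule K U a)),
      supportedIn_projModule U a, fun Y hY f => projModule_hom_eq_zero ?_⟩
    have h₁ := hF Y hY (f (projGen K U a))
    rw [← map_smul] at h₁
    rwa [idem_smul_projGen] at h₁

/-- The injective module at `a` is torsion-free if and only if all torsion modules vanish at `a`. -/
theorem right_injModule_iff [FiniteDimensional K (PathAlgebra K V)] (h : IsTorsionPairOn U T F)
    (a : V) : F (ModuleCat.of _ (injModule K U a)) ↔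
      ∀ X : ModuleCat.{u} (PathAlgebra K V), T X → ∀ x : X, (idem a : PathAlgebra K V) • x = 0 := by
  constructor
  · intro hF X hX x
    exact idem_smul_eq_zero_of_hom ((h.left_iff X).1 hX).2.1
      (fun f => h.hom_eq_zero hX hF f) x
  · intro hT
    exact (h.right_iff _).2 ⟨inferInstanceAs (Module.Finite _ (injModule K U a)),
      supportedIn_injModule U a, fun X hX f => hom_injModule_eq_zero (hT X hX)⟩

/-! #### Splitting off projective or injective modules -/

theorem right_supportedIn (h : IsTorsionPairOn U T F)
    (hU' : ∀ a ∈ U, a ∉ U' → T (ModuleCat.of _ (projModule K U a)))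
    {Y : ModuleCat.{u} (PathAlgebra K V)} (hY : F Y) : SupportedIn K U' Y := by
  intro a ha y
  by_cases haU : a ∈ U
  · exact (h.left_projModule_iff a).1 (hU' a haU ha) Y hY y
  · exact ((h.right_iff Y).1 hY).2.1 a haU y

theorem left_supportedIn [FiniteDimensional K (PathAlgebra K V)] (h : IsTorsionPairOn U T F)
    (hU' : ∀ a ∈ U, a ∉ U' → F (ModuleCat.of _ (injModule K U a)))
    {X : ModuleCat.{u} (PathAlgebra K V)} (hX : T X) : SupportedIn K U' X := by
  intro a ha x
  by_cases haU : a ∈ U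
  · exact (h.right_injModule_iff a).1 (hU' a haU ha) X hX x
  · exact ((h.left_iff X).1 hX).2.1 a haU x

/-- Torsion-free modules already vanish at the deleted vertices. For maximality of F, a map from a
torsion module to a module on `U'` is replaced by its image, which is torsion as a quotient and
supported on `U'` as a submodule. -/
theorem restrict_left (h : IsTorsionPairOn U T F) (hU : U' ⊆ U)
    (hU' : ∀ a ∈ U, a ∉ U' → T (ModuleCat.of _ (projModule K U a))) :
    IsTorsionPairOn U' (restrictTo U' T) F where
  left_eq := by
    funext X
    refine propext ⟨fun hX => ⟨((h.left_iff X).1 hX.1).1, hX.2, ((h.left_iff X).1 hX.1).2.2⟩,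
      fun hX => ⟨(h.left_iff X).2 ⟨hX.1, hX.2.1.mono hU, hX.2.2⟩, hX.2.1⟩⟩
  right_eq := by
    funext Y
    refine propext ⟨fun hY => ⟨((h.right_iff Y).1 hY).1, h.right_supportedIn hU' hY,
      fun X hX f => h.hom_eq_zero hX.1 hY f⟩, fun hY => (h.right_iff Y).2
        ⟨hY.1, hY.2.1.mono hU, fun X hX f => ?_⟩⟩
    have h₁ := hY.2.2 (ModuleCat.of _ (LinearMap.range f))
      ⟨h.left_of_surjective (Y := ModuleCat.of _ (LinearMap.range f)) hX f.rangeRestrict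
        f.surjective_rangeRestrict, hY.2.1.submodule _⟩ (LinearMap.range f).subtype
    ext x
    exact LinearMap.congr_fun h₁ (f.rangeRestrict x)

theorem restrict_right [FiniteDimensional K (PathAlgebra K V)] (h : IsTorsionPairOn U T F)
    (hU : U' ⊆ U) (hU' : ∀ a ∈ U, a ∉ U' → F (ModuleCat.of _ (injModule K U a))) :
    IsTorsionPairOn U' T (restrictTo U' F) where
  left_eq := by
    funext X
    refine propext ⟨fun hX => ⟨((h.left_iff X).1 hX).1, h.left_supportedIn hU' hX,
      fun Y hY f => h.hom_eq_zero hX hY.1 f⟩, fun hX => (h.left_iff X).2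
        ⟨hX.1, hX.2.1.mono hU, fun Y hY f => ?_⟩⟩
    have h₁ := hX.2.2 (ModuleCat.of _ (LinearMap.range f))
      ⟨h.right_of_injective (X := ModuleCat.of _ (LinearMap.range f)) hY
        (LinearMap.range f).subtype (Submodule.subtype_injective _),
        hX.2.1.of_surjective _ f.surjective_rangeRestrict⟩ f.rangeRestrict
    ext x
    exact congrArg Subtype.val (LinearMap.congr_fun h₁ x)
  right_eq := by
    funext Y
    refine propext ⟨fun hY => ⟨((h.right_iff Y).1 hY.1).1, hY.2, ((h.right_iff Y).1 hY.1).2.2⟩,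
      fun hY => ⟨(h.right_iff Y).2 ⟨hY.1, hY.2.1.mono hU, hY.2.2⟩, hY.2.1⟩⟩

/-- Modules in `F` vanish outside `U'`, so the projectives over `U` at vertices outside `U'` enter
the left perpendicular class. Anything orthogonal to that class must then vanish outside `U'`, which
is why F does not grow. -/
theorem extend_left (h : IsTorsionPairOn U' T F) (hU : U' ⊆ U) :
    IsTorsionPairOn U (leftPerp K U F) F where
  left_eq := rfl
  right_eq := by
    funext Y
    refine propext ⟨fun hY => ⟨((h.right_iff Y).1 hY).1, ((h.right_iff Y).1 hY).2.1.mono hU,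
      fun X hX f => hX.2.2 Y hY f⟩, fun hY => (h.right_iff Y).2 ⟨hY.1, fun a ha y => ?_,
        fun X hX f => hY.2.2 X ⟨((h.left_iff X).1 hX).1, ((h.left_iff X).1 hX).2.1.mono hU,
          ((h.left_iff X).1 hX).2.2⟩ f⟩⟩
    rw [← projLift_projGen hY.2.1 a y]
    refine LinearMap.congr_fun (hY.2.2 (ModuleCat.of _ (projModule K U a))
      ⟨inferInstanceAs (Module.Finite _ (projModule K U a)),
      supportedIn_projModule U a, fun Z hZ f => projModule_hom_eq_zero ?_⟩ (projLift hY.2.1 a y)) _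
    have h₁ := ((h.right_iff Z).1 hZ).2.1 a ha (f (projGen K U a))
    rw [← map_smul] at h₁
    rwa [idem_smul_projGen] at h₁

theorem extend_right [FiniteDimensional K (PathAlgebra K V)] (h : IsTorsionPairOn U' T F)
    (hU : U' ⊆ U) : IsTorsionPairOn U T (rightPerp K U T) where
  left_eq := by
    funext X
    refine propext ⟨fun hX => ⟨((h.left_iff X).1 hX).1, ((h.left_iff X).1 hX).2.1.mono hU,
      fun Y hY f => hY.2.2 X hX f⟩, fun hX => (h.left_iff X).2 ⟨hX.1, fun a ha x => ?_,
        fun Y hY f => hX.2.2 Y ⟨((h.right_iff Y).1 hY).1, ((h.right_iff Y).1 hY).2.1.mono hU,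
          ((h.right_iff Y).1 hY).2.2⟩ f⟩⟩
    refine idem_smul_eq_zero_of_hom hX.2.1 (fun f => hX.2.2 (ModuleCat.of _ (injModule K U a))
      ⟨inferInstanceAs (Module.Finite _ (injModule K U a)),
      supportedIn_injModule U a, fun Z hZ f => hom_injModule_eq_zero ?_⟩ f) x
    exact ((h.left_iff Z).1 hZ).2.1 a ha
  right_eq := rfl

/-- Extending to `U` does not change which modules on `U'` are torsion, so splittings already
arranged on smaller vertex sets survive the backward construction. -/
theorem restrictTo_leftPerp (h : IsTorsionPairOn U' T F) (hU : U' ⊆ U) :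
    restrictTo U' (leftPerp K U F) = T := by
  funext X
  exact propext ⟨fun hX => (h.left_iff X).2 ⟨hX.1.1, hX.2, hX.1.2.2⟩, fun hX =>
    ⟨⟨((h.left_iff X).1 hX).1, ((h.left_iff X).1 hX).2.1.mono hU, ((h.left_iff X).1 hX).2.2⟩,
      ((h.left_iff X).1 hX).2.1⟩⟩

theorem restrictTo_rightPerp (h : IsTorsionPairOn U' T F) (hU : U' ⊆ U) :
    restrictTo U' (rightPerp K U T) = F := by
  funext X
  exact propext ⟨fun hX => (h.right_iff X).2 ⟨hX.1.1, hX.2, hX.1.2.2⟩, fun hX =>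
    ⟨⟨((h.right_iff X).1 hX).1, ((h.right_iff X).1 hX).2.1.mono hU, ((h.right_iff X).1 hX).2.2⟩,
      ((h.right_iff X).1 hX).2.1⟩⟩

/-- Every module is an extension of a torsion-free one by a torsion one. -/
theorem exists_submodule [FiniteDimensional K (PathAlgebra K V)] (h : IsTorsionPairOn U T F)
    (X : ModuleCat.{u} (PathAlgebra K V)) (hX : Module.Finite (PathAlgebra K V) X)
    (hXU : SupportedIn K U X) : ∃ A : Submodule (PathAlgebra K V) X,
      T (ModuleCat.of _ A) ∧ F (ModuleCat.of _ (X ⧸ A)) := by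
  have : IsNoetherianRing (PathAlgebra K V) := IsNoetherianRing.of_finite K _
  have : IsNoetherian (PathAlgebra K V) X := isNoetherian_of_isNoetherianRing_of_finite _ _
  have hne : {A : Submodule (PathAlgebra K V) X | T (ModuleCat.of _ A)}.Nonempty :=
    ⟨⊥, (h.left_iff _).2 ⟨inferInstanceAs (Module.Finite _ (⊥ : Submodule _ X)),
      hXU.submodule _, fun Y _ f => LinearMap.ext fun x => by
        rw [show x = 0 from Subsingleton.elim (α := (⊥ : Submodule (PathAlgebra K V) X)) x 0,
          map_zero, map_zero]⟩⟩
  -- The order is reversed: `A` is a maximal torsion submodule, available because X is noetherian.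
  obtain ⟨A, hA, hmax⟩ := wellFounded_gt.has_min _ hne
  refine ⟨A, hA, (h.right_iff _).2 ⟨inferInstanceAs (Module.Finite _ (X ⧸ A)),
    hXU.of_surjective A.mkQ A.mkQ_surjective, fun Z hZ f => ?_⟩⟩
  change Z →ₗ[PathAlgebra K V] X ⧸ A at f
  let B : Submodule (PathAlgebra K V) X := (LinearMap.range f).comap A.mkQ
  have hAB : A ≤ B := fun x hx => by
    change A.mkQ x ∈ LinearMap.range f
    rw [show A.mkQ x = 0 from (Submodule.Quotient.mk_eq_zero A).2 hx]
    exact Submodule.zero_mem _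
  -- Closure under extensions: a map from `B` to a torsion-free module kills `A`, hence factors
  -- through the range of `f`, a quotient of the torsion module `Z`.
  have hB : T (ModuleCat.of _ B) := by
    refine (h.left_iff _).2 ⟨inferInstanceAs (Module.Finite _ B), hXU.submodule _,
      fun Y hY g => ?_⟩
    change B →ₗ[PathAlgebra K V] Y at g
    let q : B →ₗ[PathAlgebra K V] LinearMap.range f :=
      (A.mkQ.comp B.subtype).codRestrict (LinearMap.range f) fun b => b.2
    have hq : Function.Surjective q := by
      rintro ⟨y, hy⟩
      obtain ⟨x, rfl⟩ := A.mkQ_surjective y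
      exact ⟨⟨x, hy⟩, rfl⟩
    have hker : LinearMap.ker q ≤ LinearMap.ker g := by
      intro b hb
      have hbA : b.1 ∈ A := (Submodule.Quotient.mk_eq_zero A).1
        (congrArg Subtype.val (LinearMap.mem_ker.1 hb))
      exact LinearMap.congr_fun
        (h.hom_eq_zero (X := ModuleCat.of _ A) hA hY (g.comp (Submodule.inclusion hAB))) ⟨b.1, hbA⟩
    have h₁ := h.hom_eq_zero hZ hY ((((LinearMap.ker q).liftQ g hker).comp
      (q.quotKerEquivOfSurjective hq).symm.toLinearMap).comp f.rangeRestrict)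
    ext b
    obtain ⟨z, hz⟩ := f.surjective_rangeRestrict (q b)
    have h₂ := LinearMap.congr_fun h₁ z
    rw [LinearMap.comp_apply, hz, LinearMap.comp_apply] at h₂
    have h₃ : (q.quotKerEquivOfSurjective hq).symm (q b) = (LinearMap.ker q).mkQ b := by
      rw [LinearEquiv.symm_apply_eq]
      rfl
    rw [LinearEquiv.coe_coe, h₃] at h₂
    exact h₂
  have hBA : B = A := by
    by_contra hne'
    exact hmax B hB (lt_of_le_of_ne hAB (Ne.symm hne'))
  ext z
  obtain ⟨x, hx⟩ := A.mkQ_surjective (f z)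
  have hxA : x ∈ A := hBA ▸ (show A.mkQ x ∈ LinearMap.range f from ⟨z, hx.symm⟩)
  rw [← hx]
  exact (Submodule.Quotient.mk_eq_zero A).2 hxA

/-- An orthogonal pair on all finitely generated modules is a torsion pair. -/
def toTorsionPair [FiniteDimensional K (PathAlgebra K V)] (h : IsTorsionPairOn Set.univ T F) :
    TorsionPair (PathAlgebra K V) where
  T := T
  F := F
  T_fg X hX := ((h.left_iff X).1 hX).1
  F_fg Y hY := ((h.right_iff Y).1 hY).1
  T_iso := ⟨fun {_ _} e hX => h.left_of_surjective hX e.toLinearEquiv.toLinearMap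
    e.toLinearEquiv.surjective⟩
  F_iso := ⟨fun {_ _} e hX => h.right_of_injective hX e.toLinearEquiv.symm.toLinearMap
    e.toLinearEquiv.symm.injective⟩
  hom_eq_zero _ _ hX hY f := h.hom_eq_zero hX hY f
  exists_exact X hX := by
    obtain ⟨A, hA, hB⟩ := h.exists_submodule X hX SupportedIn.univ
    exact ⟨_, _, A.subtype, A.mkQ, hA, hB, A.subtype_injective,
      LinearMap.exact_subtype_mkQ A, A.mkQ_surjective⟩

end IsTorsionPairOn

/-- The canonical sequence collapses: if X has no nonzero map to F, its projection to the
torsion-free part is zero and X is isomorphic to its torsion part; dually on the other side. With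
`toTorsionPair`, this reduces everything to orthogonality. -/
theorem isTorsionPairOn_univ (P : TorsionPair (PathAlgebra K V)) :
    IsTorsionPairOn Set.univ P.T P.F where
  left_eq := by
    funext X
    refine propext ⟨fun hX => ⟨P.T_fg X hX, SupportedIn.univ, fun Y hY f =>
      P.hom_eq_zero X Y hX hY f⟩, fun hX => ?_⟩
    obtain ⟨A, B, i, p, hA, hB, hi, hex, hp⟩ := P.exists_exact X hX.1
    have hp0 := hX.2.2 B hB p
    have hs : Function.Surjective i := fun x => (hex x).1 (by rw [hp0, LinearMap.zero_apply])
    exact P.T_iso.of_iso (LinearEquiv.ofBijective i ⟨hi, hs⟩).toModuleIso hA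
  right_eq := by
    funext X
    refine propext ⟨fun hX => ⟨P.F_fg X hX, SupportedIn.univ, fun Y hY f =>
      P.hom_eq_zero Y X hY hX f⟩, fun hX => ?_⟩
    obtain ⟨A, B, i, p, hA, hB, hi, hex, hp⟩ := P.exists_exact X hX.1
    have hi0 := hX.2.2 A hA i
    have hs : Function.Injective p := by
      rw [injective_iff_map_eq_zero]
      intro x hx
      obtain ⟨y, rfl⟩ := (hex x).1 hx
      rw [hi0, LinearMap.zero_apply]
    exact P.F_iso.of_iso (LinearEquiv.ofBijective p ⟨hs, hp⟩).symm.toModuleIso hB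

end TorsionPairsOn

end PathAlgebra

/-! ### The linear quiver -/

namespace LinearQuiver

variable {n : ℕ}

instance (n : ℕ) : LinearOrder (LinearQuiver n) := inferInstanceAs (LinearOrder (Fin n))

theorem le_of_path {a b : LinearQuiver n} (p : Quiver.Path a b) : a ≤ b := by
  induction p with
  | nil => exact le_refl a
  | @cons b c _ e h =>
    have h₁ : Fin.val b + 1 = Fin.val c := e.down
    have h₂ : Fin.val a ≤ Fin.val b := h
    exact show Fin.val a ≤ Fin.val c by omega

/-- Each arrow raises the vertex number by one, so the last arrow of a path is determined by its
endpoint. -/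
instance (a b : LinearQuiver n) : Subsingleton (Quiver.Path a b) where
  allEq p q := by
    induction p with
    | nil =>
      cases q with
      | nil => rfl
      | @cons b _ q e =>
        have h₁ : Fin.val b + 1 = Fin.val a := e.down
        have h₂ : Fin.val a ≤ Fin.val b := le_of_path q
        omega
    | @cons b c p e ih =>
      cases q with
      | nil =>
        have h₁ : Fin.val b + 1 = Fin.val a := e.down
        have h₂ : Fin.val a ≤ Fin.val b := le_of_path p
        omega
      | @cons b' _ q e' =>
        have h₁ : Fin.val b + 1 = Fin.val c := e.down
        have h₂ : Fin.val b' + 1 = Fin.val c := e'.down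
        obtain rfl : b = b' := Fin.ext (by omega)
        rw [ih q]
        obtain ⟨e⟩ := e
        obtain ⟨e'⟩ := e'
        rfl

theorem nonempty_path {a b : LinearQuiver n} (h : a ≤ b) : Nonempty (Quiver.Path a b) := by
  obtain ⟨a, ha⟩ := a
  obtain ⟨b, hb⟩ := b
  change a ≤ b at h
  induction b, h using Nat.le_induction with
  | base => exact ⟨Quiver.Path.nil⟩
  | succ b hab ih =>
    obtain ⟨p⟩ := ih (by omega)
    let c : LinearQuiver n := (⟨b + 1, hb⟩ : Fin n)
    exact ⟨Quiver.Path.cons (c := c) p ⟨rfl⟩⟩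

/-- Every vertex of `U` is joined inside `U` to a sink of `U`. -/
theorem exists_sink {U : Set (LinearQuiver n)} {a : LinearQuiver n} (ha : a ∈ U) :
    ∃ s ∈ sinksIn U, a ≤ s ∧ Set.Icc a s ⊆ U := by
  have hfin : {b : LinearQuiver n | a ≤ b ∧ Set.Icc a b ⊆ U}.Finite := Set.toFinite _
  obtain ⟨s, hs⟩ := hfin.exists_maximal ⟨a, le_refl a, by simpa using ha⟩
  refine ⟨s, ⟨hs.1.2 ⟨hs.1.1, le_refl s⟩, fun b hb => ⟨fun e => ?_⟩⟩, hs.1⟩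
  have h₁ : Fin.val s + 1 = Fin.val b := e.down
  have hlt : s < b := show Fin.val s < Fin.val b by omega
  refine not_lt_of_ge (hs.2 ⟨hs.1.1.trans hlt.le, fun c hc => ?_⟩ hlt.le) hlt
  rcases hc.2.lt_or_eq with h | rfl
  · have h₂ : Fin.val c < Fin.val b := h
    exact hs.1.2 ⟨hc.1, show Fin.val c ≤ Fin.val s by omega⟩
  · exact hb

/-- Every vertex of `U` is joined inside `U` to a source of `U`. -/
theorem exists_source {U : Set (LinearQuiver n)} {a : LinearQuiver n} (ha : a ∈ U) :
    ∃ s ∈ sourcesIn U, s ≤ a ∧ Set.Icc s a ⊆ U := by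
  have hfin : {b : LinearQuiver n | b ≤ a ∧ Set.Icc b a ⊆ U}.Finite := Set.toFinite _
  obtain ⟨s, hs⟩ := hfin.exists_minimal ⟨a, le_refl a, by simpa using ha⟩
  refine ⟨s, ⟨hs.1.2 ⟨le_refl s, hs.1.1⟩, fun b hb => ⟨fun e => ?_⟩⟩, hs.1⟩
  have h₁ : Fin.val b + 1 = Fin.val s := e.down
  have hlt : b < s := show Fin.val b < Fin.val s by omega
  refine not_lt_of_ge (hs.2 ⟨hlt.le.trans hs.1.1, fun c hc => ?_⟩ hlt.le) hlt
  rcases hc.1.lt_or_eq with h | rfl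
  · have h₂ : Fin.val b < Fin.val c := h
    exact hs.1.2 ⟨show Fin.val s ≤ Fin.val c by omega, hc.2⟩
  · exact hb

theorem exists_notMem_of_sink {U : Set (LinearQuiver n)} {a b : LinearQuiver n}
    (ha : a ∈ sinksIn U) (h : a < b) : ∃ c, c ∉ U ∧ a ≤ c ∧ c ≤ b := by
  have h' : Fin.val a < Fin.val b := h
  let c : LinearQuiver n := (⟨Fin.val a + 1, by have := Fin.isLt b; omega⟩ : Fin n)
  exact ⟨c, fun hc => (ha.2 c hc).false ⟨rfl⟩, show Fin.val a ≤ Fin.val a + 1 by omega,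
    show Fin.val a + 1 ≤ Fin.val b from h'⟩

theorem exists_notMem_of_source {U : Set (LinearQuiver n)} {a b : LinearQuiver n}
    (ha : a ∈ sourcesIn U) (h : b < a) : ∃ c, c ∉ U ∧ b ≤ c ∧ c ≤ a := by
  have h' : Fin.val b < Fin.val a := h
  let c : LinearQuiver n := (⟨Fin.val a - 1, by have := Fin.isLt a; omega⟩ : Fin n)
  exact ⟨c, fun hc => (ha.2 c hc).false ⟨show Fin.val a - 1 + 1 = Fin.val a by omega⟩,
    show Fin.val b ≤ Fin.val a - 1 by omega, show Fin.val a - 1 ≤ Fin.val a by omega⟩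

end LinearQuiver

namespace PathAlgebra

/-! ### The path basis of the linear quiver -/

section Linear

open LinearQuiver

variable (K : Type u) [Field K] {n : ℕ}

open Classical in
/-- The path from `j` to `k` in the path algebra of the linear quiver, zero if there is none. -/
noncomputable def pathTo (k j : LinearQuiver n) : PathAlgebra K (LinearQuiver n) :=
  if h : j ≤ k then ofPath ⟨j, k, (nonempty_path h).some⟩ else 0

theorem ofPath_eq_pathTo {j k : LinearQuiver n} (p : Quiver.Path j k) :
    (ofPath ⟨j, k, p⟩ : PathAlgebra K (LinearQuiver n)) = pathTo K k j := by
  rw [pathTo, dif_pos (le_of_path p), Subsingleton.elim p (nonempty_path (le_of_path p)).some]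

theorem pathTo_of_not_le {j k : LinearQuiver n} (h : ¬ j ≤ k) : pathTo K k j = 0 := dif_neg h

theorem pathTo_self (k : LinearQuiver n) : pathTo K k k = idem k := (ofPath_eq_pathTo K _).symm

theorem pathTo_mul_pathTo {j k l : LinearQuiver n} (hjk : j ≤ k) (hkl : k ≤ l) :
    pathTo K l k * pathTo K k j = pathTo K l j := by
  obtain ⟨p⟩ := nonempty_path hjk
  obtain ⟨q⟩ := nonempty_path hkl
  rw [← ofPath_eq_pathTo K p, ← ofPath_eq_pathTo K q, ofPath_mul_ofPath,
    ← ofPath_eq_pathTo K (p.comp q)]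
  simp [mulPath]

theorem idem_mul_pathTo (k j : LinearQuiver n) : idem k * pathTo K k j = pathTo K k j := by
  by_cases h : j ≤ k
  · rw [← pathTo_self, pathTo_mul_pathTo K h (le_refl k)]
  · rw [pathTo_of_not_le K h, mul_zero]

theorem pathTo_mul_idem (k j : LinearQuiver n) : pathTo K k j * idem j = pathTo K k j := by
  by_cases h : j ≤ k
  · rw [← pathTo_self, pathTo_mul_pathTo K (le_refl j) h]
  · rw [pathTo_of_not_le K h, zero_mul]

theorem idem_mul_pathTo_of_ne {i k : LinearQuiver n} (h : i ≠ k) (j : LinearQuiver n) :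
    idem i * pathTo K k j = 0 := by
  rw [← idem_mul_pathTo, ← mul_assoc, idem_mul_of_ne h, zero_mul]

theorem pathTo_mul_idem_of_ne {i j : LinearQuiver n} (h : j ≠ i) (k : LinearQuiver n) :
    pathTo K k j * idem i = 0 := by
  rw [← pathTo_mul_idem, mul_assoc, idem_mul_of_ne h, mul_zero]

/-- The coefficient of the path from `j` to `k`. -/
noncomputable def coeffTo (k j : LinearQuiver n) : PathAlgebra K (LinearQuiver n) →ₗ[K] K :=
  lift fun p => if p.1 = j ∧ p.2.1 = k then 1 else 0

variable {K}

theorem coeffTo_pathTo {j k : LinearQuiver n} (h : j ≤ k) : coeffTo K k j (pathTo K k j) = 1 := by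
  obtain ⟨p⟩ := nonempty_path h
  rw [← ofPath_eq_pathTo K p, coeffTo, lift_ofPath, if_pos ⟨rfl, rfl⟩]

theorem coeffTo_pathTo_of_ne {j k j' k' : LinearQuiver n} (h : ¬ (j' = j ∧ k' = k)) :
    coeffTo K k j (pathTo K k' j') = 0 := by
  by_cases h' : j' ≤ k'
  · obtain ⟨p⟩ := nonempty_path h'
    rw [← ofPath_eq_pathTo K p, coeffTo, lift_ofPath, if_neg h]
  · rw [pathTo_of_not_le K h', map_zero]

/-- At most one path joins two vertices, so e_k Λ e_j has dimension at most one; computations with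
components become computations with scalars. -/
theorem idem_mul_mul_idem (k j : LinearQuiver n) (x : PathAlgebra K (LinearQuiver n)) :
    idem k * x * idem j = coeffTo K k j x • pathTo K k j := by
  have h : (LinearMap.mulRight K (idem j)).comp (LinearMap.mulLeft K (idem k)) =
      (coeffTo K k j).smulRight (pathTo K k j) := hom_ext fun p => by
    obtain ⟨i, l, p⟩ := p
    simp only [LinearMap.comp_apply, LinearMap.mulLeft_apply, LinearMap.mulRight_apply,
      LinearMap.smulRight_apply, ofPath_eq_pathTo]
    by_cases hl : l = k
    · subst hl
      by_cases hi : i = j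
      · subst hi
        rw [idem_mul_pathTo, pathTo_mul_idem, coeffTo_pathTo (le_of_path p), one_smul]
      · rw [idem_mul_pathTo, pathTo_mul_idem_of_ne K hi, coeffTo_pathTo_of_ne fun h => hi h.1, zero_smul]
    · rw [idem_mul_pathTo_of_ne K (Ne.symm hl), coeffTo_pathTo_of_ne fun h => hl h.2, zero_smul,
        zero_mul]
  exact LinearMap.congr_fun h x

theorem sum_coeffTo_smul (x : PathAlgebra K (LinearQuiver n)) :
    ∑ k, ∑ j, coeffTo K k j x • pathTo K k j = x := by
  simp_rw [← idem_mul_mul_idem, ← Finset.mul_sum, ← one_def, mul_one]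
  rw [← Finset.sum_mul, ← one_def, one_mul]

instance : FiniteDimensional K (PathAlgebra K (LinearQuiver n)) := by
  refine ⟨Submodule.fg_def.2 ⟨Set.range fun p : LinearQuiver n × LinearQuiver n =>
    pathTo K p.1 p.2, Set.finite_range _, eq_top_iff.2 fun x _ => ?_⟩⟩
  rw [← sum_coeffTo_smul x]
  refine Submodule.sum_mem _ fun k _ => Submodule.sum_mem _ fun j _ => Submodule.smul_mem _ _
    (Submodule.subset_span ⟨(k, j), rfl⟩)

/-- A path inside `U` does not lie in the ideal generated by the vertices outside `U`. -/
theorem coeffTo_eq_zero_of_mem {U : Set (LinearQuiver n)} {j k : LinearQuiver n}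
    (hU : Set.Icc j k ⊆ U) {x : PathAlgebra K (LinearQuiver n)} (hx : x ∈ outsideIdeal K U) :
    coeffTo K k j x = 0 := by
  -- The end vertex has to vary in the induction: left multiplication by a path from j' to k turns a
  -- coefficient at k into one at j', and the shorter interval from j to j' still lies in `U`.
  suffices h : ∀ k, Set.Icc j k ⊆ U → coeffTo K k j x = 0 from h k hU
  clear hU
  induction hx using Submodule.span_induction with
  | mem x hx =>
    obtain ⟨w, hw, y, rfl⟩ := hx
    intro k hk
    by_cases hjk : j ≤ k
    · rw [← sum_coeffTo_smul y]
      simp only [Finset.mul_sum, map_sum, mul_smul_comm, map_smul, smul_eq_mul]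
      refine Finset.sum_eq_zero fun k' _ => Finset.sum_eq_zero fun j' _ => ?_
      by_cases hk' : w = k'
      · subst hk'
        rw [idem_mul_pathTo, coeffTo_pathTo_of_ne, mul_zero]
        rintro ⟨-, rfl⟩
        exact hw (hk ⟨hjk, le_refl w⟩)
      · rw [idem_mul_pathTo_of_ne K hk', map_zero, mul_zero]
    · have : (coeffTo K k j : PathAlgebra K (LinearQuiver n) →ₗ[K] K) = 0 := hom_ext fun p => by
        rw [coeffTo, lift_ofPath, if_neg, LinearMap.zero_apply]
        rintro ⟨rfl, rfl⟩
        exact hjk (le_of_path p.2.2)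
      rw [this, LinearMap.zero_apply]
  | zero => exact fun _ _ => map_zero _
  | add x y _ _ h₁ h₂ =>
    intro k hk
    rw [map_add, h₁ k hk, h₂ k hk, add_zero]
  | smul c x _ h =>
    intro k hk
    rw [smul_eq_mul, ← sum_coeffTo_smul c]
    simp only [Finset.sum_mul, map_sum, smul_mul_assoc, map_smul, smul_eq_mul]
    refine Finset.sum_eq_zero fun k' _ => Finset.sum_eq_zero fun j' _ => ?_
    have h₁ : pathTo K k' j' * x = ∑ i, coeffTo K j' i x • (pathTo K k' j' * pathTo K j' i) := by
      rw [← pathTo_mul_idem, mul_assoc, ← mul_one (idem j' * x), one_def, Finset.mul_sum,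
        Finset.mul_sum]
      simp only [idem_mul_mul_idem, mul_smul_comm]
      simp only [mul_assoc, idem_mul_pathTo]
    rw [h₁, map_sum, Finset.sum_eq_zero, mul_zero]
    intro i _
    rw [map_smul, smul_eq_mul]
    by_cases hi : i ≤ j'
    · by_cases hj' : j' ≤ k'
      · rw [pathTo_mul_pathTo K hi hj']
        by_cases he : i = j ∧ k' = k
        · obtain ⟨rfl, rfl⟩ := he
          rw [h j' fun y hy => hk ⟨hy.1, hy.2.trans hj'⟩, zero_mul]
        · rw [coeffTo_pathTo_of_ne he, mul_zero]
      · rw [pathTo_of_not_le K hj', zero_mul, map_zero, mul_zero]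
    · rw [pathTo_of_not_le K hi, mul_zero, map_zero, mul_zero]

/-! ### Submodules of injective modules and quotients of projective modules -/

variable {U : Set (LinearQuiver n)} {M : Type*} [AddCommGroup M]
  [Module (PathAlgebra K (LinearQuiver n)) M]

theorem idem_smul_smul (x : PathAlgebra K (LinearQuiver n)) (k : LinearQuiver n)
    {j : LinearQuiver n} {m : M} (hm : (idem j : PathAlgebra K (LinearQuiver n)) • m = m) :
    (idem k : PathAlgebra K (LinearQuiver n)) • x • m =
      (coeffTo K k j x • pathTo K k j : PathAlgebra K (LinearQuiver n)) • m := by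
  rw [← idem_mul_mul_idem, mul_smul, hm, mul_smul]

/-- A path through a vertex l outside `U` acts through e_l M, which is zero. -/
theorem smul_pathTo_smul_eq_zero (hM : SupportedIn K U M) {j k l : LinearQuiver n}
    (hl : l ∉ U) (hjl : j ≤ l) (hlk : l ≤ k) (c : K) (m : M) :
    (c • pathTo K k j : PathAlgebra K (LinearQuiver n)) • m = 0 := by
  rw [← pathTo_mul_pathTo K hjl hlk, ← idem_mul_pathTo K l, ← smul_mul_assoc, mul_smul, mul_smul,
    hM l hl, smul_zero]

theorem DualRegular.apply_eq {f : DualRegular K (LinearQuiver n)} {a k : LinearQuiver n}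
    (hf : ∀ x, f (idem a * x) = f x)
    (hk : (idem k : PathAlgebra K (LinearQuiver n)) • f = f) (x : PathAlgebra K (LinearQuiver n)) :
    f x = coeffTo K a k x * f (pathTo K a k) := by
  have h : f (x * idem k) = f x := congrArg (fun g : DualRegular K (LinearQuiver n) => g x) hk
  rw [← h, ← hf, ← mul_assoc, idem_mul_mul_idem, DualRegular.map_smul]

/-- Since e_a Λ e_k is spanned by one path, an element of the injective located at k is determined
by its value on that path. -/
theorem injModule_ext {a k : LinearQuiver n} {f g : injModule K U a}
    (hf : (idem k : PathAlgebra K (LinearQuiver n)) • f = f)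
    (hg : (idem k : PathAlgebra K (LinearQuiver n)) • g = g)
    (h : f.1 (pathTo K a k) = g.1 (pathTo K a k)) : f = g := by
  refine Subtype.ext (DualRegular.ext fun x => ?_)
  rw [DualRegular.apply_eq (fun x => injModule_idem_mul f x) (congrArg Subtype.val hf), h,
    ← DualRegular.apply_eq (fun x => injModule_idem_mul g x) (congrArg Subtype.val hg)]

theorem DualRegular.smul_smul_apply (f : DualRegular K (LinearQuiver n)) (c : K)
    (x y : PathAlgebra K (LinearQuiver n)) : ((c • x) • f) y = c * f (y * x) := by
  rw [DualRegular.smul_apply, mul_smul_comm, DualRegular.map_smul]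

/-- A nonzero submodule of the injective module at a sink of `U` is projective over the path
algebra of `U`. -/
theorem exists_projModule_equiv {a : LinearQuiver n} (ha : a ∈ sinksIn U)
    (N : Submodule (PathAlgebra K (LinearQuiver n)) (injModule K U a)) (hN : N ≠ ⊥) :
    ∃ j ∈ U, Nonempty (projModule K U j ≃ₗ[PathAlgebra K (LinearQuiver n)] N) := by
  have hNU : SupportedIn K U N := (supportedIn_injModule U a).submodule N
  have hfin : {j : LinearQuiver n |
    ∃ m : N, (idem j : PathAlgebra K (LinearQuiver n)) • m ≠ 0}.Finite := Set.toFinite _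
  -- The first vertex at which `N` is nonzero; an element there will generate `N`.
  obtain ⟨j, ⟨m₀, hm₀⟩, hj⟩ := hfin.exists_minimal (by
    by_contra! h
    refine hN (eq_bot_iff.2 fun m hm => ?_)
    have h₁ : (⟨m, hm⟩ : N) = 0 := by
      rw [← sum_idem_smul (K := K) (V := LinearQuiver n) (⟨m, hm⟩ : N)]
      refine Finset.sum_eq_zero fun k _ => ?_
      by_contra hk
      exact (Set.eq_empty_iff_forall_notMem.1 h k) ⟨_, hk⟩
    exact congrArg Subtype.val h₁)
  obtain ⟨e, he⟩ : ∃ e : N, e = (idem j : PathAlgebra K (LinearQuiver n)) • m₀ := ⟨_, rfl⟩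
  have hje : (idem j : PathAlgebra K (LinearQuiver n)) • e = e := by
    rw [he]
    exact idem_smul_idem_smul j m₀
  have hje' : (idem j : PathAlgebra K (LinearQuiver n)) • e.1 = e.1 := congrArg Subtype.val hje
  have he0 : e.1.1 (pathTo K a j) ≠ 0 := by
    intro h
    refine hm₀ (he ▸ Subtype.ext (injModule_ext hje' (smul_zero _) (h.trans ?_)))
    rfl
  have hja : j ≤ a := by
    by_contra h
    exact he0 (by rw [pathTo_of_not_le K h, DualRegular.map_zero])
  refine ⟨j, hNU.mem_of_ne_zero hm₀,
    ⟨LinearEquiv.ofBijective (projLift hNU j e) ⟨?_, ?_⟩⟩⟩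
  · rw [injective_iff_map_eq_zero]
    intro z hz
    obtain ⟨x, rfl⟩ := exists_smul_projGen z
    rw [map_smul, projLift_projGen, hje] at hz
    rw [← sum_idem_smul (K := K) (V := LinearQuiver n) (x • projGen K U j)]
    refine Finset.sum_eq_zero fun k _ => ?_
    refine (idem_smul_smul (M := projModule K U j) x k (idem_smul_projGen U j)).trans ?_
    by_cases hjk : j ≤ k
    · by_cases hka : k ≤ a
      · have h₁ : (coeffTo K k j x • pathTo K k j : PathAlgebra K (LinearQuiver n)) • e = 0 := by
          rw [← idem_smul_smul (M := N) x k hje, hz, smul_zero]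
        have h₂ : ((coeffTo K k j x • pathTo K k j : PathAlgebra K (LinearQuiver n)) • e.1.1)
            (pathTo K a k) = 0 :=
          congrArg (fun g : N => g.1.1 (pathTo K a k)) h₁
        rw [DualRegular.smul_smul_apply, pathTo_mul_pathTo K hjk hka] at h₂
        rw [(mul_eq_zero.1 h₂).resolve_right he0, zero_smul, zero_smul]
      -- Beyond the sink a the projective vanishes, because a path from j to k crosses a vertex
      -- missing from `U`.
      · obtain ⟨l, hl, hal, hlk⟩ := exists_notMem_of_sink ha (not_le.1 hka)
        exact smul_pathTo_smul_eq_zero (supportedIn_projModule U j) hl (hja.trans hal) hlk _ _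
    · rw [pathTo_of_not_le K hjk, smul_zero, zero_smul]
  · rw [← LinearMap.range_eq_top, eq_top_iff]
    intro m _
    rw [← sum_idem_smul (K := K) (V := LinearQuiver n) m]
    refine Submodule.sum_mem _ fun k _ => ?_
    by_cases hjk : j ≤ k
    -- The component of I(a) at k is at most one-dimensional, and the translate of e along the path
    -- from j to k has value e(path from j to a) on the path from k to a; the quotient of values is
    -- the required scalar.
    · refine ⟨(((m.1.1 (pathTo K a k)) / (e.1.1 (pathTo K a j))) • pathTo K k j) •
        projGen K U j, ?_⟩
      rw [map_smul, projLift_projGen, hje]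
      refine Subtype.ext (injModule_ext (k := k) ?_ ?_ ?_)
      · change _ • _ • e.1 = _ • e.1
        rw [smul_smul, mul_smul_comm, idem_mul_pathTo]
      · exact idem_smul_idem_smul k m.1
      · change ((((m.1.1 (pathTo K a k)) / (e.1.1 (pathTo K a j))) • pathTo K k j) • e.1.1)
          (pathTo K a k) = m.1.1 (pathTo K a k * idem k)
        rw [DualRegular.smul_smul_apply, pathTo_mul_idem]
        by_cases hka : k ≤ a
        · rw [pathTo_mul_pathTo K hjk hka, div_mul_cancel₀ _ he0]
        · rw [pathTo_of_not_le K hka, zero_mul, DualRegular.map_zero, DualRegular.map_zero,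
            mul_zero]
    · have : (idem k : PathAlgebra K (LinearQuiver n)) • m = 0 := by
        by_contra h
        exact hjk (hj ⟨m, h⟩ (not_le.1 hjk).le)
      rw [this]
      exact Submodule.zero_mem _

/-- A nonzero module generated by an element at a source of `U` is injective over the path
algebra of `U`. -/
theorem exists_equiv_injModule [Module K M] [IsScalarTower K (PathAlgebra K (LinearQuiver n)) M]
    (hM : SupportedIn K U M) {a : LinearQuiver n} (ha : a ∈ sourcesIn U) {e : M} (he0 : e ≠ 0)
    (hae : (idem a : PathAlgebra K (LinearQuiver n)) • e = e)
    (hspan : ∀ m : M, ∃ x : PathAlgebra K (LinearQuiver n), m = x • e) :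
    ∃ j ∈ U, Nonempty (M ≃ₗ[PathAlgebra K (LinearQuiver n)] injModule K U j) := by
  have hfin : {j : LinearQuiver n | pathTo K j a • e ≠ 0}.Finite := Set.toFinite _
  -- The last vertex that e reaches. It carries the socle of M, which singles out the injective at
  -- j.
  obtain ⟨j, hj0, hj⟩ := hfin.exists_maximal ⟨a, by
    change pathTo K a a • e ≠ 0
    rwa [pathTo_self, hae]⟩
  have haj : a ≤ j := by
    by_contra h
    exact hj0 (by rw [pathTo_of_not_le K h, zero_smul])
  obtain ⟨φ, hφ⟩ := Module.Projective.exists_dual_ne_zero K (x := pathTo K j a • e) hj0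
  have hjU : j ∈ U := hM.mem_of_ne_zero (a := j) (x := pathTo K j a • e) (by
    rwa [smul_smul, idem_mul_pathTo])
  have happly : ∀ (c : K) (k : LinearQuiver n), a ≤ k → k ≤ j →
      (injLift hM j φ ((c • pathTo K k a : PathAlgebra K (LinearQuiver n)) • e)).1
        (pathTo K j k) = c * φ (pathTo K j a • e) := by
    intro c k hak hkj
    rw [injLift_apply, idem_mul_pathTo, smul_smul, mul_smul_comm, pathTo_mul_pathTo K hak hkj,
      smul_assoc, map_smul, smul_eq_mul]
  refine ⟨j, hjU, ⟨LinearEquiv.ofBijective (injLift hM j φ) ⟨?_, ?_⟩⟩⟩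
  · rw [injective_iff_map_eq_zero]
    intro m hm
    obtain ⟨x, rfl⟩ := hspan m
    rw [← sum_idem_smul (K := K) (V := LinearQuiver n) (x • e)]
    refine Finset.sum_eq_zero fun k _ => ?_
    have h₁ : injLift hM j φ ((idem k : PathAlgebra K (LinearQuiver n)) • x • e) = 0 := by
      rw [map_smul, hm, smul_zero]
    rw [idem_smul_smul x k hae] at h₁ ⊢
    by_cases hak : a ≤ k
    · by_cases hkj : k ≤ j
      · have h₂ := happly (coeffTo K k a x) k hak hkj
        rw [h₁] at h₂
        rw [(mul_eq_zero.1 h₂.symm).resolve_right hφ, zero_smul, zero_smul]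
      · have h₂ : pathTo K k a • e = 0 := by
          by_contra h
          exact hkj (hj h (not_le.1 hkj).le)
        rw [smul_assoc, h₂, smul_zero]
    · rw [pathTo_of_not_le K hak, smul_zero, zero_smul]
  · rw [← LinearMap.range_eq_top, eq_top_iff]
    intro f _
    rw [← sum_idem_smul (K := K) (V := LinearQuiver n) f]
    refine Submodule.sum_mem _ fun k _ => ?_
    by_cases hkj : k ≤ j
    · by_cases hak : a ≤ k
      · refine ⟨(((f.1 (pathTo K j k)) / φ (pathTo K j a • e)) • pathTo K k a :
          PathAlgebra K (LinearQuiver n)) • e, injModule_ext (k := k) ?_ ?_ ?_⟩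
        · rw [← map_smul, smul_smul, mul_smul_comm, idem_mul_pathTo]
        · exact idem_smul_idem_smul k f
        · rw [happly _ k hak hkj, div_mul_cancel₀ _ hφ]
          change _ = f.1 (pathTo K j k * idem k)
          rw [pathTo_mul_idem]
      -- Before the source a the injective vanishes too: the path from k to j crosses a missing
      -- vertex and so lies in the ideal killed by f.
      · obtain ⟨l, hl, hkl, hla⟩ := exists_notMem_of_source ha (not_le.1 hak)
        have : (idem k : PathAlgebra K (LinearQuiver n)) • f = 0 := by
          refine injModule_ext (idem_smul_idem_smul k f) (smul_zero _) ?_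
          change f.1 (pathTo K j k * idem k) = 0
          rw [pathTo_mul_idem]
          refine injModule_apply_eq_zero f ?_
          rw [← pathTo_mul_pathTo K hkl (hla.trans haj), ← idem_mul_pathTo K l]
          exact mul_idem_mul_mem_outsideIdeal hl _ _
        rw [this]
        exact Submodule.zero_mem _
    · have : (idem k : PathAlgebra K (LinearQuiver n)) • f = 0 := by
        refine injModule_ext (idem_smul_idem_smul k f) (smul_zero _) ?_
        change f.1 (pathTo K j k * idem k) = 0
        rw [pathTo_mul_idem, pathTo_of_not_le K hkj, DualRegular.map_zero]
      rw [this]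
      exact Submodule.zero_mem _

end Linear

end PathAlgebra

/-! ### Sequences of parts -/

/-- The vertices outside the first `i` members of a sequence of sets of vertices. -/
def restOf {V : Type*} (D : ℕ → Set V) (i : ℕ) : Set V := {a | ∀ j < i, a ∉ D j}

section RestOf

variable {V : Type*} {D : ℕ → Set V}

theorem restOf_zero : restOf D 0 = Set.univ :=
  Set.eq_univ_of_forall fun _ _ hj => (Nat.not_lt_zero _ hj).elim

theorem mem_restOf_succ {i : ℕ} {a : V} : a ∈ restOf D (i + 1) ↔ a ∈ restOf D i ∧ a ∉ D i := by
  refine ⟨fun h => ⟨fun j hj => h j (by omega), h i (by omega)⟩, fun h j hj => ?_⟩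
  rcases Nat.lt_succ_iff_lt_or_eq.1 hj with hj | rfl
  · exact h.1 j hj
  · exact h.2

theorem restOf_anti {i j : ℕ} (h : i ≤ j) : restOf D j ⊆ restOf D i :=
  fun _ ha k hk => ha k (hk.trans_le h)

end RestOf

namespace PathAlgebra

/-! ### Iterated splitting determines the torsion pair -/

section Splitting

open CategoryTheory

variable {K : Type u} {V : Type} [Field K] [Quiver.{0} V] [DecidableEq V] [Fintype V]
  {U U' : Set V} {T F T' F' : ObjectProperty (ModuleCat.{u} (PathAlgebra K V))}
  {D : ℕ → Set V} {N : ℕ}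

theorem restrictTo_univ : restrictTo Set.univ T = T :=
  funext fun _ => propext ⟨fun h => h.1, fun h => ⟨h, SupportedIn.univ⟩⟩

theorem restrictTo_restrictTo (hU : U' ⊆ U) : restrictTo U' (restrictTo U T) = restrictTo U' T :=
  funext fun _ => propext ⟨fun h => ⟨h.1.1, h.2⟩, fun h => ⟨⟨h.1, h.2.mono hU⟩, h.2⟩⟩

theorem restrictTo_eq_of_supportedIn (hU : U' ⊆ U)
    (h : ∀ X : ModuleCat.{u} (PathAlgebra K V), restrictTo U T X → SupportedIn K U' X) :
    restrictTo U T = restrictTo U' T :=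
  funext fun X => propext ⟨fun hX => ⟨hX.1, h X hX⟩, fun hX => ⟨hX.1, hX.2.mono hU⟩⟩

theorem restrictTo_projModule_iff (a : V) :
    restrictTo U T (ModuleCat.of _ (projModule K U a)) ↔ T (ModuleCat.of _ (projModule K U a)) :=
  ⟨fun h => h.1, fun h => ⟨h, supportedIn_projModule U a⟩⟩

theorem restrictTo_injModule_iff (a : V) :
    restrictTo U F (ModuleCat.of _ (injModule K U a)) ↔ F (ModuleCat.of _ (injModule K U a)) :=
  ⟨fun h => h.1, fun h => ⟨h, supportedIn_injModule U a⟩⟩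

/-- The member `i` of the sequence `D` consists of the vertices, among those outside the preceding
members, whose projective module lies in `T` (`i` even) or whose injective module lies in `F`
(`i` odd). -/
def SplitsAt (T F : ObjectProperty (ModuleCat.{u} (PathAlgebra K V))) (D : ℕ → Set V) (i : ℕ) :
    Prop :=
  ∀ a ∈ restOf D i,
    (Even i → (a ∈ D i ↔ T (ModuleCat.of _ (projModule K (restOf D i) a)))) ∧
    (Odd i → (a ∈ D i ↔ F (ModuleCat.of _ (injModule K (restOf D i) a))))

theorem restrictTo_right_succ {i : ℕ} (h : IsTorsionPairOn (restOf D i) (restrictTo (restOf D i) T)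
    (restrictTo (restOf D i) F)) (hs : SplitsAt T F D i) (hi : Even i) :
    restrictTo (restOf D i) F = restrictTo (restOf D (i + 1)) F := by
  refine restrictTo_eq_of_supportedIn (restOf_anti i.le_succ) fun X hX =>
    h.right_supportedIn (fun a ha ha' => (restrictTo_projModule_iff a).2 ?_) hX
  refine ((hs a ha).1 hi).1 ?_
  by_contra haD
  exact ha' (mem_restOf_succ.2 ⟨ha, haD⟩)

theorem restrictTo_left_succ [FiniteDimensional K (PathAlgebra K V)] {i : ℕ}
    (h : IsTorsionPairOn (restOf D i) (restrictTo (restOf D i) T)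
    (restrictTo (restOf D i) F)) (hs : SplitsAt T F D i) (hi : Odd i) :
    restrictTo (restOf D i) T = restrictTo (restOf D (i + 1)) T := by
  refine restrictTo_eq_of_supportedIn (restOf_anti i.le_succ) fun X hX =>
    h.left_supportedIn (fun a ha ha' => (restrictTo_injModule_iff a).2 ?_) hX
  refine ((hs a ha).2 hi).1 ?_
  by_contra haD
  exact ha' (mem_restOf_succ.2 ⟨ha, haD⟩)

variable [FiniteDimensional K (PathAlgebra K V)]

/-- An even step leaves the restricted torsion-free class unchanged and cuts down the torsion class;
an odd step does the reverse. Each is one application of `restrict_left` or `restrict_right`. -/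
theorem isTorsionPairOn_restOf (h : IsTorsionPairOn Set.univ T F) (hs : ∀ i < N, SplitsAt T F D i)
    {i : ℕ} (hi : i ≤ N) : IsTorsionPairOn (restOf D i) (restrictTo (restOf D i) T)
      (restrictTo (restOf D i) F) := by
  induction i with
  | zero => rwa [restOf_zero, restrictTo_univ, restrictTo_univ]
  | succ i ih =>
    have h₁ := ih (by omega)
    have h₂ := hs i hi
    have hU : restOf D (i + 1) ⊆ restOf D i := restOf_anti i.le_succ
    have hD : ∀ a ∈ restOf D i, a ∉ restOf D (i + 1) → a ∈ D i := fun a ha ha' => by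
      by_contra haD
      exact ha' (mem_restOf_succ.2 ⟨ha, haD⟩)
    rcases Nat.even_or_odd i with hi | hi
    · rw [← restrictTo_right_succ h₁ h₂ hi, ← restrictTo_restrictTo (T := T) hU]
      exact h₁.restrict_left hU fun a ha ha' => (restrictTo_projModule_iff a).2
        (((h₂ a ha).1 hi).1 (hD a ha ha'))
    · rw [← restrictTo_left_succ h₁ h₂ hi, ← restrictTo_restrictTo (T := F) hU]
      exact h₁.restrict_right hU fun a ha ha' => (restrictTo_injModule_iff a).2
        (((h₂ a ha).2 hi).1 (hD a ha ha'))

/-- After splitting off all projectives of `T`, no projective module lies in `T`. -/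
theorem not_left_projModule_of_splitsAt (h : IsTorsionPairOn Set.univ T F)
    (hs : ∀ i < N, SplitsAt T F D i) {i : ℕ} (hi : i < N) (hie : Even i) {a : V}
    (ha : a ∈ restOf D (i + 1)) :
    ¬ T (ModuleCat.of _ (projModule K (restOf D (i + 1)) a)) := by
  intro hT
  have h₀ := isTorsionPairOn_restOf h hs hi.le
  have h₁ := isTorsionPairOn_restOf h hs (Nat.succ_le_of_lt hi)
  -- The projectives before and after the step differ, but the criterion for being torsion mentions
  -- only the torsion-free class, which an even step does not alter.
  rw [← restrictTo_projModule_iff (T := T), h₁.left_projModule_iff,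
    ← restrictTo_right_succ h₀ (hs i hi) hie, ← h₀.left_projModule_iff,
    restrictTo_projModule_iff] at hT
  exact (mem_restOf_succ.1 ha).2 (((hs i hi a (mem_restOf_succ.1 ha).1).1 hie).2 hT)

/-- After splitting off all injectives of `F`, no injective module lies in `F`. -/
theorem not_right_injModule_of_splitsAt (h : IsTorsionPairOn Set.univ T F)
    (hs : ∀ i < N, SplitsAt T F D i) {i : ℕ} (hi : i < N) (hio : Odd i) {a : V}
    (ha : a ∈ restOf D (i + 1)) :
    ¬ F (ModuleCat.of _ (injModule K (restOf D (i + 1)) a)) := by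
  intro hF
  have h₀ := isTorsionPairOn_restOf h hs hi.le
  have h₁ := isTorsionPairOn_restOf h hs (Nat.succ_le_of_lt hi)
  rw [← restrictTo_injModule_iff (F := F), h₁.right_injModule_iff,
    ← restrictTo_left_succ h₀ (hs i hi) hio, ← h₀.right_injModule_iff,
    restrictTo_injModule_iff] at hF
  exact (mem_restOf_succ.1 ha).2 (((hs i hi a (mem_restOf_succ.1 ha).1).2 hio).2 hF)

/-- A torsion pair is determined by an exhausting sequence of parts. -/
theorem eq_of_splitsAt (h : IsTorsionPairOn Set.univ T F) (h' : IsTorsionPairOn Set.univ T' F')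
    (hs : ∀ i < N, SplitsAt T F D i) (hs' : ∀ i < N, SplitsAt T' F' D i)
    (hN : restOf D N = ∅) : T = T' ∧ F = F' := by
  -- Induction backwards from the empty remainder. At an even stage the torsion-free classes agree
  -- by the next stage and the torsion classes are their perpendiculars; at an odd stage the roles
  -- are exchanged.
  have key : ∀ k i, i + k = N → restrictTo (restOf D i) T = restrictTo (restOf D i) T' ∧
      restrictTo (restOf D i) F = restrictTo (restOf D i) F' := by
    intro k
    induction k with
    | zero =>
      rintro i rfl
      have h₁ := isTorsionPairOn_restOf h hs le_rfl
      have h₂ := isTorsionPairOn_restOf h' hs' le_rfl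
      rw [add_zero] at hN
      rw [add_zero, hN] at h₁ h₂
      rw [hN]
      have hsub : ∀ X Y : ModuleCat.{u} (PathAlgebra K V), SupportedIn K (∅ : Set V) X →
          ∀ f : X →ₗ[PathAlgebra K V] Y, f = 0 := fun X Y hX f => by
        have := hX.subsingleton
        exact LinearMap.ext fun x => by
          rw [Subsingleton.elim x 0, map_zero, map_zero]
      have hsub' : ∀ X Y : ModuleCat.{u} (PathAlgebra K V), SupportedIn K (∅ : Set V) Y →
          ∀ f : X →ₗ[PathAlgebra K V] Y, f = 0 := fun X Y hY f => by
        have := hY.subsingleton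
        exact LinearMap.ext fun x => Subsingleton.elim _ _
      constructor
      · funext X
        refine propext ((h₁.left_iff X).trans (Iff.trans ?_ (h₂.left_iff X).symm))
        exact and_congr_right fun _ => and_congr_right fun hX =>
          ⟨fun _ Y _ f => hsub X Y hX f, fun _ Y _ f => hsub X Y hX f⟩
      · funext X
        refine propext ((h₁.right_iff X).trans (Iff.trans ?_ (h₂.right_iff X).symm))
        exact and_congr_right fun _ => and_congr_right fun hX =>
          ⟨fun _ Y _ f => hsub' Y X hX f, fun _ Y _ f => hsub' Y X hX f⟩
    | succ k ih =>
      intro i hi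
      obtain ⟨hT, hF⟩ := ih (i + 1) (by omega)
      have h₁ := isTorsionPairOn_restOf h hs (i := i) (by omega)
      have h₂ := isTorsionPairOn_restOf h' hs' (i := i) (by omega)
      have hiN : i < N := by omega
      rcases Nat.even_or_odd i with hi | hi
      · have hF' : restrictTo (restOf D i) F = restrictTo (restOf D i) F' := by
          rw [restrictTo_right_succ h₁ (hs i hiN) hi, restrictTo_right_succ h₂ (hs' i hiN) hi, hF]
        exact ⟨by rw [h₁.left_eq, h₂.left_eq, hF'], hF'⟩
      · have hT' : restrictTo (restOf D i) T = restrictTo (restOf D i) T' := by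
          rw [restrictTo_left_succ h₁ (hs i hiN) hi, restrictTo_left_succ h₂ (hs' i hiN) hi, hT]
        exact ⟨hT', by rw [h₁.right_eq, h₂.right_eq, hT']⟩
  simpa only [restOf_zero, restrictTo_univ] using key N 0 (zero_add N)

end Splitting

/-! ### Sinks, sources and the backward construction -/

section Linear

open CategoryTheory LinearQuiver

variable {K : Type u} [Field K] {n : ℕ} {U : Set (LinearQuiver n)}
  {T F : ObjectProperty (ModuleCat.{u} (PathAlgebra K (LinearQuiver n)))}
  {D : ℕ → Set (LinearQuiver n)} {N : ℕ}

/-- The image of a torsion module in the injective is torsion. If nonzero it would be isomorphic to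
one of the projectives that `hno` excludes. -/
theorem IsTorsionPairOn.right_injModule_of_sink (h : IsTorsionPairOn U T F) {a : LinearQuiver n}
    (ha : a ∈ sinksIn U) (hno : ∀ j ∈ U, ¬ T (ModuleCat.of _ (projModule K U j))) :
    F (ModuleCat.of _ (injModule K U a)) := by
  refine (h.right_iff _).2 ⟨inferInstanceAs (Module.Finite _ (injModule K U a)),
    supportedIn_injModule U a, fun X hX f => ?_⟩
  change X →ₗ[_] injModule K U a at f
  by_contra hf
  obtain ⟨j, hj, ⟨e⟩⟩ := exists_projModule_equiv ha (LinearMap.range f)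
    (fun h => hf (LinearMap.range_eq_bot.1 h))
  exact hno j hj (h.left_of_surjective (Y := ModuleCat.of _ (projModule K U j)) hX
    (e.symm.toLinearMap.comp f.rangeRestrict)
    (e.symm.surjective.comp f.surjective_rangeRestrict))

/-- The image of the projective in a torsion-free module is torsion-free. If nonzero it would be one
of the excluded injectives, being generated at a source. -/
theorem IsTorsionPairOn.left_projModule_of_source (h : IsTorsionPairOn U T F) {a : LinearQuiver n}
    (ha : a ∈ sourcesIn U) (hno : ∀ j ∈ U, ¬ F (ModuleCat.of _ (injModule K U j))) :
    T (ModuleCat.of _ (projModule K U a)) := by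
  refine (h.left_iff _).2 ⟨inferInstanceAs (Module.Finite _ (projModule K U a)),
    supportedIn_projModule U a, fun Y hY f => ?_⟩
  change projModule K U a →ₗ[_] Y at f
  by_contra hf
  let _ : Module K (LinearMap.range f) :=
    Module.compHom _ (algebraMap K (PathAlgebra K (LinearQuiver n)))
  have : IsScalarTower K (PathAlgebra K (LinearQuiver n)) (LinearMap.range f) :=
    ⟨fun c x m => by
      change (c • x) • m = algebraMap K (PathAlgebra K (LinearQuiver n)) c • x • m
      rw [Algebra.smul_def, mul_smul]⟩
  obtain ⟨j, hj, ⟨e⟩⟩ := exists_equiv_injModule (M := LinearMap.range f)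
    ((supportedIn_projModule U a).of_surjective f.rangeRestrict f.surjective_rangeRestrict) ha
    (e := f.rangeRestrict (projGen K U a))
    (fun h₀ => hf (projModule_hom_eq_zero (congrArg Subtype.val h₀)))
    (by rw [← map_smul, idem_smul_projGen])
    (fun m => by
      obtain ⟨z, rfl⟩ := f.surjective_rangeRestrict m
      obtain ⟨x, rfl⟩ := exists_smul_projGen z
      exact ⟨x, map_smul _ _ _⟩)
  exact hno j hj (h.right_of_injective (X := ModuleCat.of _ (injModule K U j)) hY
    ((LinearMap.range f).subtype.comp e.symm.toLinearMap)
    ((LinearMap.range f).subtype_injective.comp e.symm.injective))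

theorem sinksIn_subset_of_splitsAt (h : IsTorsionPairOn Set.univ T F)
    (hs : ∀ i, i < N → SplitsAt T F D i) {i : ℕ} (hi : i < N) (hio : Odd i) :
    sinksIn (restOf D i) ⊆ D i := by
  intro a ha
  -- An odd stage has a predecessor, whose even step has used up all projectives in T.
  obtain ⟨i, rfl⟩ : ∃ k, i = k + 1 := ⟨i - 1, by have := hio.pos; omega⟩
  have hie : Even i := by rw [Nat.odd_add_one, Nat.not_odd_iff_even] at hio; exact hio
  refine ((hs _ hi a ha.1).2 hio).2 ((restrictTo_injModule_iff a).1 ?_)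
  exact (isTorsionPairOn_restOf h hs hi.le).right_injModule_of_sink ha fun j hj hT =>
    not_left_projModule_of_splitsAt h hs (by omega) hie hj ((restrictTo_projModule_iff j).1 hT)

theorem sourcesIn_subset_of_splitsAt (h : IsTorsionPairOn Set.univ T F)
    (hs : ∀ i, i < N → SplitsAt T F D i) {i : ℕ} (hi : i < N) (hi0 : i ≠ 0) (hie : Even i) :
    sourcesIn (restOf D i) ⊆ D i := by
  intro a ha
  obtain ⟨i, rfl⟩ : ∃ k, i = k + 1 := ⟨i - 1, by omega⟩
  have hio : Odd i := by rw [Nat.even_add_one, Nat.not_even_iff_odd] at hie; exact hie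
  refine ((hs _ hi a ha.1).1 hie).2 ((restrictTo_projModule_iff a).1 ?_)
  exact (isTorsionPairOn_restOf h hs hi.le).left_projModule_of_source ha fun j hj hT =>
    not_right_injModule_of_splitsAt h hs (by omega) hio hj ((restrictTo_injModule_iff j).1 hT)

/-- The witness is the coefficient of the path from a to s: it kills the ideal because this path
stays inside `U`. -/
theorem exists_idem_smul_injModule_ne_zero {a s : LinearQuiver n} (has : a ≤ s)
    (hU : Set.Icc a s ⊆ U) :
    ∃ f : injModule K U s, (idem a : PathAlgebra K (LinearQuiver n)) • f ≠ 0 := by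
  have hidem : ∀ x, coeffTo K s a (idem s * x) = coeffTo K s a x := by
    intro x
    have h : idem s * (idem s * x) * idem a = idem s * x * idem a := by
      rw [← mul_assoc (idem s), idem_mul_self]
    rw [idem_mul_mul_idem, idem_mul_mul_idem] at h
    simpa [coeffTo_pathTo has] using congrArg (coeffTo K s a) h
  refine ⟨⟨(coeffTo K s a : PathAlgebra K (LinearQuiver n) →ₗ[K] K), hidem,
    fun x hx => coeffTo_eq_zero_of_mem hU hx⟩, fun h => ?_⟩
  have h₁ : coeffTo K s a (pathTo K s a * idem a) = 0 :=
    congrArg (fun f : injModule K U s => f.1 (pathTo K s a)) h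
  rw [pathTo_mul_idem, coeffTo_pathTo has] at h₁
  exact one_ne_zero h₁

theorem exists_idem_smul_projModule_ne_zero {a s : LinearQuiver n} (hsa : s ≤ a)
    (hU : Set.Icc s a ⊆ U) :
    ∃ x : projModule K U s, (idem a : PathAlgebra K (LinearQuiver n)) • x ≠ 0 := by
  refine ⟨pathTo K a s • projGen K U s, fun h => ?_⟩
  have h₁ : (outsideIdeal K U).mkQ (idem a * (pathTo K a s * idem s)) = 0 :=
    congrArg Subtype.val h
  rw [pathTo_mul_idem, idem_mul_pathTo, Submodule.mkQ_apply,
    Submodule.Quotient.mk_eq_zero] at h₁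
  have h₂ := coeffTo_eq_zero_of_mem hU h₁
  rw [coeffTo_pathTo hsa] at h₂
  exact one_ne_zero h₂

/-- Every exhausting sequence of parts that contains the relevant sinks and sources comes from a
torsion pair. -/
theorem exists_isTorsionPairOn (hN : restOf D N = ∅)
    (hsinks : ∀ i < N, Odd i → sinksIn (restOf D i) ⊆ D i)
    (hsources : ∀ i < N, i ≠ 0 → Even i → sourcesIn (restOf D i) ⊆ D i) :
    ∃ T F : ObjectProperty (ModuleCat.{u} (PathAlgebra K (LinearQuiver n))),
      IsTorsionPairOn Set.univ T F ∧ ∀ i < N, SplitsAt T F D i := by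
  have key : ∀ k i, i + k = N →
      ∃ T F : ObjectProperty (ModuleCat.{u} (PathAlgebra K (LinearQuiver n))),
        IsTorsionPairOn (restOf D i) T F ∧ ∀ j < N, i ≤ j → SplitsAt T F D j := by
    intro k
    induction k with
    | zero =>
      rintro i rfl
      rw [add_zero] at hN
      rw [hN]
      -- On the empty vertex set all modules are zero, so the orthogonality conditions are vacuous.
      refine ⟨leftPerp K ∅ ⊥, rightPerp K ∅ (leftPerp K ∅ ⊥), ⟨funext fun X => propext ?_, rfl⟩,
        fun j hj hij => absurd hj (by omega)⟩
      refine and_congr_right fun _ => and_congr_right fun hX => ⟨fun _ Y _ f => ?_,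
        fun _ Y hY => hY.elim⟩
      have := hX.subsingleton
      exact LinearMap.ext fun x => by rw [Subsingleton.elim x 0, map_zero, map_zero]
    | succ k ih =>
      intro i hi
      obtain ⟨T, F, h, hs⟩ := ih (i + 1) (by omega)
      have hiN : i < N := by omega
      have hU : restOf D (i + 1) ⊆ restOf D i := restOf_anti i.le_succ
      -- A surviving vertex forces a further part, so the sink or source condition at stage i + 1
      -- applies. The condition at stage i itself is never needed, which leaves the initial part
      -- free.
      have hlt : ∀ a ∈ restOf D (i + 1), i + 1 < N := fun a ha => by
        rcases eq_or_ne (i + 1) N with h₁ | h₁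
        · rw [h₁, hN] at ha
          exact ha.elim
        · omega
      rcases Nat.even_or_odd i with hie | hio
      · have hP := h.extend_left hU
        refine ⟨leftPerp K (restOf D i) F, F, hP, fun j hj hij a ha => ?_⟩
        rcases hij.eq_or_lt with rfl | hij
        · refine ⟨fun _ => ⟨fun haD => ?_, fun hT => ?_⟩,
            fun hio => (Nat.not_odd_iff_even.2 hie hio).elim⟩
          · exact (hP.left_projModule_iff a).2 fun Y hY =>
              ((h.right_iff Y).1 hY).2.1 a fun ha' => (mem_restOf_succ.1 ha').2 haD
          · by_contra haD
            have ha' : a ∈ restOf D (i + 1) := mem_restOf_succ.2 ⟨ha, haD⟩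
            -- The injective at a sink s reachable from a is torsion-free by the next stage and
            -- nonzero at a, so the projective at a cannot be torsion.
            obtain ⟨s, hs₁, has, hIcc⟩ := exists_sink ha'
            have hi₁ := hlt a ha'
            obtain ⟨f, hf⟩ := exists_idem_smul_injModule_ne_zero (K := K) has hIcc
            refine hf ((hP.left_projModule_iff a).1 hT
              (ModuleCat.of _ (injModule K (restOf D (i + 1)) s)) ?_ f)
            exact ((hs _ hi₁ le_rfl s hs₁.1).2 hie.add_one).1
              (hsinks _ hi₁ hie.add_one hs₁)
        · refine ⟨fun hje => ((hs j hj hij a ha).1 hje).trans ?_, (hs j hj hij a ha).2⟩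
          -- For a later stage j the projective lives on the smaller remainder, where the old and
          -- the extended torsion classes coincide.
          nth_rewrite 1 [← h.restrictTo_leftPerp hU]
          exact ⟨fun h₁ => h₁.1,
            fun h₁ => ⟨h₁, (supportedIn_projModule _ a).mono (restOf_anti hij)⟩⟩
      · have hP := h.extend_right hU
        refine ⟨T, rightPerp K (restOf D i) T, hP, fun j hj hij a ha => ?_⟩
        rcases hij.eq_or_lt with rfl | hij
        · refine ⟨fun hie => (Nat.not_odd_iff_even.2 hie hio).elim,
            fun _ => ⟨fun haD => ?_, fun hF => ?_⟩⟩
          · exact (hP.right_injModule_iff a).2 fun X hX =>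
              ((h.left_iff X).1 hX).2.1 a fun ha' => (mem_restOf_succ.1 ha').2 haD
          · by_contra haD
            have ha' : a ∈ restOf D (i + 1) := mem_restOf_succ.2 ⟨ha, haD⟩
            obtain ⟨s, hs₁, has, hIcc⟩ := exists_source ha'
            have hi₁ := hlt a ha'
            obtain ⟨x, hx⟩ := exists_idem_smul_projModule_ne_zero (K := K) has hIcc
            refine hx ((hP.right_injModule_iff a).1 hF
              (ModuleCat.of _ (projModule K (restOf D (i + 1)) s)) ?_ x)
            exact ((hs _ hi₁ le_rfl s hs₁.1).1 hio.add_one).1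
              (hsources _ hi₁ (Nat.succ_ne_zero i) hio.add_one hs₁)
        · refine ⟨(hs j hj hij a ha).1, fun hjo => ((hs j hj hij a ha).2 hjo).trans ?_⟩
          nth_rewrite 1 [← h.restrictTo_rightPerp hU]
          exact ⟨fun h₁ => h₁.1,
            fun h₁ => ⟨h₁, (supportedIn_injModule _ a).mono (restOf_anti hij)⟩⟩
  obtain ⟨T, F, h, hs⟩ := key N 0 (zero_add N)
  rw [restOf_zero] at h
  exact ⟨T, F, h, fun i hi => hs i hi (Nat.zero_le i)⟩

end Linear

end PathAlgebra

/-! ### Part partitions as sequences -/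

namespace StrongOneTypePartPartition

variable {V : Type v} [Quiver.{w} V]

/-- The parts of a part partition, continued by empty sets. -/
def part (S : StrongOneTypePartPartition V) (i : ℕ) : Set V :=
  {a | ∃ h : i < S.m + 1, a ∈ S.Δ ⟨i, h⟩}

theorem part_val (S : StrongOneTypePartPartition V) (i : Fin (S.m + 1)) : S.part i = S.Δ i :=
  Set.ext fun _ => ⟨fun h => h.2, fun h => ⟨i.2, h⟩⟩

theorem restBefore_eq (S : StrongOneTypePartPartition V) (i : Fin (S.m + 1)) :
    restBefore S.Δ i = restOf S.part i :=
  Set.ext fun _ => ⟨fun h j hj ⟨h₁, h₂⟩ => h ⟨j, h₁⟩ hj h₂,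
    fun h j hj hj' => h j hj (by rwa [part_val])⟩

theorem part_subset_restOf (S : StrongOneTypePartPartition V) (i : ℕ) :
    S.part i ⊆ restOf S.part i := by
  rintro a ⟨hi, ha⟩ j hj ⟨hj', ha'⟩
  exact Set.disjoint_left.1 (S.disjoint ⟨j, hj'⟩ ⟨i, hi⟩
    fun h => hj.ne (congrArg Fin.val h)) ha' ha

theorem IsComplete.restOf_eq_empty {S : StrongOneTypePartPartition V} (h : S.IsComplete) :
    restOf S.part (S.m + 1) = ∅ := by
  refine Set.eq_empty_of_forall_notMem fun a ha => ?_
  obtain ⟨i, hi⟩ := Set.mem_iUnion.1 (h.symm ▸ Set.mem_univ a : a ∈ ⋃ i, S.Δ i)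
  exact ha i i.2 (by rwa [part_val])

theorem ext_part {S S' : StrongOneTypePartPartition V} (hm : S.m = S'.m)
    (h : ∀ i < S.m + 1, S.part i = S'.part i) : S = S' := by
  obtain ⟨m, Δ, _, _, _, _⟩ := S
  obtain ⟨m', Δ', _, _, _, _⟩ := S'
  obtain rfl : m = m' := hm
  obtain rfl : Δ = Δ' := by
    funext i
    have h₁ := h i i.2
    rwa [part_val, part_val] at h₁
  rfl

end StrongOneTypePartPartition

open PathAlgebra in
theorem isDecompositionOf_iff {K : Type u} {V : Type} [Field K] [Quiver.{0} V] [DecidableEq V]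
    [Fintype V] (S : StrongOneTypePartPartition V) (P : TorsionPair (PathAlgebra K V)) :
    IsDecompositionOf S P ↔ ∀ i < S.m + 1, SplitsAt P.T P.F S.part i := by
  constructor
  · intro h i hi a ha
    have h₁ := h ⟨i, hi⟩ a
    rw [S.restBefore_eq, ← S.part_val] at h₁
    exact h₁ ha
  · intro h i
    rw [S.restBefore_eq, ← S.part_val]
    exact h i i.2

open PathAlgebra in
/-- The part partition belonging to a torsion pair is unique. -/
theorem IsDecompositionOf.unique {K : Type u} {V : Type} [Field K] [Quiver.{0} V] [DecidableEq V]
    [Fintype V] {S S' : StrongOneTypePartPartition V} {P : TorsionPair (PathAlgebra K V)}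
    (hS : S.IsComplete) (hS' : S'.IsComplete) (h : IsDecompositionOf S P)
    (h' : IsDecompositionOf S' P) : S = S' := by
  rw [isDecompositionOf_iff] at h h'
  have hpart : ∀ i, i < S.m + 1 → i < S'.m + 1 → S.part i = S'.part i := by
    intro i
    induction i using Nat.strong_induction_on with
    | _ i ih =>
      intro hi hi'
      have hrest : restOf S.part i = restOf S'.part i := Set.ext fun a =>
        forall₂_congr fun j hj => by rw [ih j hj (by omega) (by omega)]
      ext a
      by_cases ha : a ∈ restOf S.part i
      · have h₁ := h i hi a ha
        have h₂ := h' i hi' a (hrest ▸ ha)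
        rw [← hrest] at h₂
        rcases Nat.even_or_odd i with hie | hio
        · exact (h₁.1 hie).trans (h₂.1 hie).symm
        · exact (h₁.2 hio).trans (h₂.2 hio).symm
      · exact ⟨fun h₁ => (ha (S.part_subset_restOf i h₁)).elim,
          fun h₁ => (ha (hrest ▸ S'.part_subset_restOf i h₁)).elim⟩
  -- If R' were longer, its part of index R.m + 1 would be nonempty, as the index is positive, yet
  -- would lie in the final remainder of R, which is empty.
  have hle : ∀ {R R' : StrongOneTypePartPartition V}, R.IsComplete →
      (∀ i, i < R.m + 1 → i < R'.m + 1 → R.part i = R'.part i) → R'.m ≤ R.m := by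
    intro R R' hR hRR'
    by_contra! hlt
    obtain ⟨a, ha⟩ := R'.nonempty ⟨R.m + 1, by omega⟩ (fun h => by simpa using congrArg Fin.val h)
    have ha' : a ∈ restOf R.part (R.m + 1) := fun j hj => by
      rw [hRR' j hj (by omega)]
      exact R'.part_subset_restOf (R.m + 1) ⟨by omega, ha⟩ j hj
    rw [hR.restOf_eq_empty] at ha'
    exact ha'
  have hm : S.m = S'.m :=
    le_antisymm (hle hS' fun i hi hi' => (hpart i hi' hi).symm) (hle hS hpart)
  exact StrongOneTypePartPartition.ext_part hm fun i hi => hpart i hi (hm ▸ hi)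

/-! ### From torsion pairs to part partitions and back -/

section Existence

open PathAlgebra

variable {K : Type u} [Field K] {n : ℕ}

/-- The remainders obtained from a torsion pair by alternately splitting off projectives of `T`
and injectives of `F`. -/
def splitRest (P : TorsionPair (PathAlgebra K (LinearQuiver n))) : ℕ → Set (LinearQuiver n)
  | 0 => Set.univ
  | i + 1 => {a | a ∈ splitRest P i ∧
      -- Exactly one premise holds, so the conjunction is a case distinction on the parity of i.
      ¬ ((Even i → P.T (ModuleCat.of _ (projModule K (splitRest P i) a))) ∧
        (Odd i → P.F (ModuleCat.of _ (injModule K (splitRest P i) a))))}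

/-- The parts obtained from a torsion pair by alternately splitting off projectives of `T`
and injectives of `F`. -/
def splitPart (P : TorsionPair (PathAlgebra K (LinearQuiver n))) (i : ℕ) :
    Set (LinearQuiver n) := splitRest P i \ splitRest P (i + 1)

theorem restOf_splitPart (P : TorsionPair (PathAlgebra K (LinearQuiver n))) (i : ℕ) :
    restOf (splitPart P) i = splitRest P i := by
  induction i with
  | zero => exact restOf_zero
  | succ i ih =>
    ext a
    rw [mem_restOf_succ, ih, splitPart, Set.mem_sdiff, not_and_not_right]
    exact ⟨fun h => h.2 h.1, fun h => ⟨h.1, fun _ => h⟩⟩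

theorem splitsAt_splitPart (P : TorsionPair (PathAlgebra K (LinearQuiver n))) (i : ℕ) :
    SplitsAt P.T P.F (splitPart P) i := by
  intro a ha
  rw [restOf_splitPart] at ha ⊢
  have h : a ∈ splitPart P i ↔
      ((Even i → P.T (ModuleCat.of _ (projModule K (splitRest P i) a))) ∧
        (Odd i → P.F (ModuleCat.of _ (injModule K (splitRest P i) a)))) :=
    ⟨fun h => by_contra fun h' => h.2 ⟨ha, h'⟩, fun h => ⟨ha, fun h' => h'.2 h⟩⟩
  rw [h]
  exact ⟨fun hie => ⟨fun h₁ => h₁.1 hie, fun h₁ => ⟨fun _ => h₁,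
    fun hio => (Nat.not_odd_iff_even.2 hie hio).elim⟩⟩, fun hio => ⟨fun h₁ => h₁.2 hio,
    fun h₁ => ⟨fun hie => (Nat.not_odd_iff_even.2 hie hio).elim, fun _ => h₁⟩⟩⟩

/-- A nonempty remainder has a sink and a source, and the part at a positive stage absorbs those of
the relevant kind. This drives termination. -/
theorem nonempty_splitPart (P : TorsionPair (PathAlgebra K (LinearQuiver n))) {i : ℕ} (hi : i ≠ 0)
    (h : (restOf (splitPart P) i).Nonempty) : (splitPart P i).Nonempty := by
  obtain ⟨a, ha⟩ := h
  rcases Nat.even_or_odd i with hie | hio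
  · obtain ⟨s, hs, -⟩ := LinearQuiver.exists_source ha
    exact ⟨s, sourcesIn_subset_of_splitsAt (isTorsionPairOn_univ P)
      (fun j _ => splitsAt_splitPart P j) (Nat.lt_succ_self i) hi hie hs⟩
  · obtain ⟨s, hs, -⟩ := LinearQuiver.exists_sink ha
    exact ⟨s, sinksIn_subset_of_splitsAt (isTorsionPairOn_univ P)
      (fun j _ => splitsAt_splitPart P j) (Nat.lt_succ_self i) hio hs⟩

theorem disjoint_splitPart (P : TorsionPair (PathAlgebra K (LinearQuiver n))) {i j : ℕ}
    (hij : i ≠ j) : Disjoint (splitPart P i) (splitPart P j) := by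
  have h : ∀ {i j : ℕ}, i < j → Disjoint (splitPart P i) (splitPart P j) := fun {i j} hij =>
    Set.disjoint_left.2 fun a ha ha' => by
      have h₁ : a ∈ restOf (splitPart P) j := by
        rw [restOf_splitPart]
        exact ha'.1
      exact h₁ i hij ha
  rcases hij.lt_or_gt with hij | hij
  · exact h hij
  · exact (h hij).symm

theorem exists_restOf_splitPart_eq_empty (P : TorsionPair (PathAlgebra K (LinearQuiver n))) :
    ∃ m, restOf (splitPart P) (m + 1) = ∅ := by
  by_contra! h
  -- The shift by one skips the initial part, which may be empty. Infinitely many disjoint nonempty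
  -- parts would embed ℕ in a finite vertex set.
  have hne : ∀ m, (splitPart P (m + 1)).Nonempty := fun m =>
    nonempty_splitPart P (Nat.succ_ne_zero m) (h m)
  choose f hf using hne
  refine not_injective_infinite_finite f fun i j hij => ?_
  by_contra hne
  exact Set.disjoint_left.1 (disjoint_splitPart P (i := i + 1) (j := j + 1) (by omega)) (hf i)
    (hij ▸ hf j)

/-- Every torsion pair has a complete part partition. -/
theorem exists_isDecompositionOf (P : TorsionPair (PathAlgebra K (LinearQuiver n))) :
    ∃ S : StrongOneTypePartPartition (LinearQuiver n), S.IsComplete ∧ IsDecompositionOf S P := by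
  classical
  -- Minimality of m keeps the remainders at stages 1, …, m nonempty, hence also the corresponding
  -- parts.
  obtain ⟨m, hm, hmin⟩ : ∃ m, restOf (splitPart P) (m + 1) = ∅ ∧
      ∀ k < m, restOf (splitPart P) (k + 1) ≠ ∅ :=
    ⟨_, Nat.find_spec (exists_restOf_splitPart_eq_empty P),
      fun _ hk => Nat.find_min (exists_restOf_splitPart_eq_empty P) hk⟩
  have hrest : ∀ i : Fin (m + 1), restBefore (fun i : Fin (m + 1) => splitPart P i) i =
      restOf (splitPart P) i := fun i => Set.ext fun a =>
    ⟨fun h j hj => h ⟨j, hj.trans i.2⟩ hj, fun h j hj => h j hj⟩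
  have hP := isTorsionPairOn_univ P
  have hs : ∀ j, j < m + 1 → SplitsAt P.T P.F (splitPart P) j := fun j _ => splitsAt_splitPart P j
  refine ⟨⟨m, fun i => splitPart P i, fun i hi => ?_, fun i j hij => ?_, fun i hi => ?_,
    fun i hi hie => ?_⟩, ?_, ?_⟩
  · have hi0 : (i : ℕ) ≠ 0 := fun h => hi (Fin.ext h)
    refine nonempty_splitPart P hi0 ?_
    have h₁ := hmin (i - 1) (by omega)
    rw [Nat.sub_add_cancel (Nat.pos_of_ne_zero hi0)] at h₁
    exact Set.nonempty_iff_ne_empty.2 h₁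
  · exact disjoint_splitPart P fun h => hij (Fin.ext h)
  · rw [hrest]
    exact sinksIn_subset_of_splitsAt hP hs i.2 hi
  · rw [hrest]
    exact sourcesIn_subset_of_splitsAt hP hs i.2 (fun h => hi (Fin.ext h)) hie
  · refine Set.eq_univ_of_forall fun a => ?_
    by_contra ha
    have h₁ : a ∈ restOf (splitPart P) (m + 1) := fun j hj hja =>
      ha (Set.mem_iUnion.2 ⟨⟨j, hj⟩, hja⟩)
    rw [hm] at h₁
    exact h₁
  · intro i
    change ∀ a ∈ restBefore (fun i : Fin (m + 1) => splitPart P i) i, _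
    dsimp only
    rw [hrest]
    exact hs i i.2

/-- Every complete part partition comes from a torsion pair. -/
theorem exists_torsionPair_isDecompositionOf {S : StrongOneTypePartPartition (LinearQuiver n)}
    (hS : S.IsComplete) :
    ∃ P : TorsionPair (PathAlgebra K (LinearQuiver n)), IsDecompositionOf S P := by
  obtain ⟨T, F, h, hs⟩ := exists_isTorsionPairOn (K := K) hS.restOf_eq_empty
    (fun i hi hio => by
      have h₁ := S.sinks_subset ⟨i, hi⟩ hio
      rwa [S.restBefore_eq, ← S.part_val] at h₁)
    (fun i hi hi0 hie => by
      have h₁ := S.sources_subset ⟨i, hi⟩ (fun h => hi0 (congrArg Fin.val h)) hie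
      rwa [S.restBefore_eq, ← S.part_val] at h₁)
  exact ⟨h.toTorsionPair, (isDecompositionOf_iff S _).2 hs⟩

/-- A torsion pair is determined by its part partition. -/
theorem torsionPair_eq_of_isDecompositionOf {S : StrongOneTypePartPartition (LinearQuiver n)}
    (hS : S.IsComplete) {P P' : TorsionPair (PathAlgebra K (LinearQuiver n))}
    (h : IsDecompositionOf S P) (h' : IsDecompositionOf S P') : P = P' := by
  rw [isDecompositionOf_iff] at h h'
  obtain ⟨hT, hF⟩ := eq_of_splitsAt (isTorsionPairOn_univ P) (isTorsionPairOn_univ P') h h'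
    hS.restOf_eq_empty
  exact TorsionPair.ext hT hF

end Existence

theorem theorem4p4 (K : Type u) [Field K] (n : ℕ) :
    ∃ Φ : TorsionPair (PathAlgebra K (LinearQuiver n)) ≃
        {S : StrongOneTypePartPartition (LinearQuiver n) // S.IsComplete},
      ∀ P, IsDecompositionOf (Φ P).1 P := by
  choose f hf using fun P : TorsionPair (PathAlgebra K (LinearQuiver n)) =>
    exists_isDecompositionOf P
  refine ⟨Equiv.ofBijective (fun P => ⟨f P, (hf P).1⟩) ⟨fun P P' h => ?_, fun S => ?_⟩,
    fun P => (hf P).2⟩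
  · have h₁ : f P = f P' := congrArg Subtype.val h
    exact torsionPair_eq_of_isDecompositionOf (hf P).1 (hf P).2 (h₁ ▸ (hf P').2)
  · obtain ⟨P, hP⟩ := exists_torsionPair_isDecompositionOf (K := K) S.2
    exact ⟨P, Subtype.ext ((hf P).2.unique (hf P).1 S.2 hP)⟩
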